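/- Let $\mathbb K\in\{\mathbb R,\mathbb C\}$, and let $G$ and $N$ be Lie groups over $\mathbb K$ modelled on (Hausdorff) locally convex spaces, where smoothness is understood as follows: a map on an open set is $C^1$ if it is continuous and has directional derivatives $df(x)(h)$ depending continuously on $(x,h)$, it is $C^n$ if moreover $df$ is $C^{n-1}$, and it is smooth if it is $C^n$ for all $n$. A *smooth factor system* for $(G,N)$ is a pair $(S,\omega)$ of maps $S\colon G\to \operatorname{Aut}(N)$ (Lie group automorphisms) and $\omega\colon G\times G\to N$ such that - $S(1)=\mathrm{id}_N$, and $(g,n)\mapsto S(g)(n)$ is smooth on $U\times N$ for some open identity neighbourhood $U\subseteq G$; - $\omega(g,1)=\omega(1,g)=1$ for all $g$, $\omega$ is smooth on an identity neighbourhood of $G\times G$, and for each $g\in G$ the map $x\mapsto\omega(g,x)\,\omega(gxg^{-1},g)^{-1}$ is smooth on an identity neighbourhood of $G$; - $S(g)S(g')S(gg')^{-1}=C_N(\omega(g,g'))$, where $C_N(n)(n')=nn'n^{-1}$, and $S(g)(\omega(g',g''))\,\omega(g,g'g'')\,\omega(gg',g'')^{-1}\,\omega(g,g')^{-1}=1$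 for all $g,g',g''\in G$. For such a pair, $N\times_{(S,\omega)}G$ denotes the set $N\times G$ with the group multiplication $(n,g)(n',g')=(n\,S(g)(n')\,\omega(g,g'),\,gg')$. An *extension of Lie groups* of $G$ by $N$ is a short exact sequence $1\to N\xrightarrow{\iota}\widehat G\xrightarrow{q}G\to1$ of smooth homomorphisms of Lie groups for which $q$ is a locally trivial smooth $N$-principal bundle. Two extensions are *equivalent* if there is an isomorphism of Lie groups between the middle groups commuting with the maps from $N$ and to $G$. (1) Let $(S,\omega)$ be a smooth factor system. Then $N\times_{(S,\omega)}G$ carries a unique Lie group structure for which there is an open identity neighbourhood $U\subseteq G$ such that the identity map $N\times G\to N\times_{(S,\omega)}G$ restricts to a diffeomorphism of $N\times U$ onto an open subset. With this structure, $q(n,g)=g$ and $\iota(n)=(n,1)$ define an extension of Lie groups of $G$ by $N$. It is also the only Lie group structure on $N\times_{(S,\omega)}G$ for which the identity map is smooth on $N\times U$ for some open identity neighbourhood $U\subseteq G$ and for which $(\iota,q)$ is an extension of Lie groups of $G$ by $N$. (Lie group structures are compared without fixing the model space; two are the same if the identity is a diffeomorphism.) (2) Conversely, let $N\xrightarrow{\iota}\widehat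 G\xrightarrow{q}G$ be an extension of Lie groups. Then there is a section $\sigma\colon G\to\widehat G$ of $q$ with $\sigma(1)=1$ that is smooth on an identity neighbourhood. For every such $\sigma$, let $S(g)\in\operatorname{Aut}(N)$ be given by $\iota(S(g)(n))=\sigma(g)\iota(n)\sigma(g)^{-1}$, and $\omega=\delta_\sigma$ by $\iota(\omega(g,g'))=\sigma(g)\sigma(g')\sigma(gg')^{-1}$. Then $(S,\omega)$ is a smooth factor system, and the given extension is equivalent to $N\times_{(S,\omega)}G$ with the Lie group structure from (1). -/

import Mathlib

open Set Filter Topology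

namespace LCLie

/-! ### Calculus in locally convex spaces -/

/-- Hausdorff locally convex topological vector spaces over `𝕜 = ℝ` or `ℂ`. -/
class LocallyConvexTVS (𝕜 E : Type*) [RCLike 𝕜] [AddCommGroup E] [Module 𝕜 E]
    [TopologicalSpace E] : Prop extends
    IsTopologicalAddGroup E, ContinuousSMul 𝕜 E, T2Space E where
  locallyConvex :
    letI : Module ℝ E := Module.compHom E (algebraMap ℝ 𝕜)
    LocallyConvexSpace ℝ E

instance {𝕜 E F : Type*} [RCLike 𝕜] [AddCommGroup E] [Module 𝕜 E] [TopologicalSpace E]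
    [LocallyConvexTVS 𝕜 E] [AddCommGroup F] [Module 𝕜 F] [TopologicalSpace F]
    [LocallyConvexTVS 𝕜 F] : LocallyConvexTVS 𝕜 (E × F) where
  locallyConvex := by
    let : Module ℝ E := Module.compHom E (algebraMap ℝ 𝕜)
    let : Module ℝ F := Module.compHom F (algebraMap ℝ 𝕜)
    have : LocallyConvexSpace ℝ E := LocallyConvexTVS.locallyConvex (𝕜 := 𝕜)
    have : LocallyConvexSpace ℝ F := LocallyConvexTVS.locallyConvex (𝕜 := 𝕜)
    exact (inferInstance : LocallyConvexSpace ℝ (E × F))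

/-- `y` is the derivative of `f` at `x` in the direction `h`:
`y = lim_{t → 0} (f (x + t h) - f x) / t`. -/
def HasDirDeriv (𝕜 : Type*) {E F : Type*} [RCLike 𝕜] [AddCommGroup E] [Module 𝕜 E]
    [AddCommGroup F] [Module 𝕜 F] [TopologicalSpace F] (f : E → F) (x h : E) (y : F) : Prop :=
  Tendsto (fun t : 𝕜 => t⁻¹ • (f (x + t • h) - f x)) (𝓝[≠] 0) (𝓝 y)

/-- `f` is a `C^n`-map on the open set `U`: it is continuous on `U`, and if `n ≥ 1` then all
directional derivatives `df(x)(h)`, `x ∈ U`, exist and `df : U × E → F` is a `C^(n-1)`-map. -/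
def CnOn (𝕜 : Type*) [RCLike 𝕜] {F : Type*} [AddCommGroup F] [Module 𝕜 F] [TopologicalSpace F] :
    (n : ℕ) → {E : Type*} → [AddCommGroup E] → [Module 𝕜 E] → [TopologicalSpace E] →
      (f : E → F) → (U : Set E) → Prop
  | 0, _, _, _, _, f, U => ContinuousOn f U
  | n + 1, E, _, _, _, f, U =>
      ContinuousOn f U ∧ ∃ df : E × E → F,
        (∀ x ∈ U, ∀ h, HasDirDeriv 𝕜 f x h (df (x, h))) ∧ CnOn 𝕜 n df (U ×ˢ univ)

/-- `f` is smooth (`C^∞`) on the open set `U`. -/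
def SmoothOn (𝕜 : Type*) [RCLike 𝕜] {E F : Type*} [AddCommGroup E] [Module 𝕜 E]
    [TopologicalSpace E] [AddCommGroup F] [Module 𝕜 F] [TopologicalSpace F]
    (f : E → F) (U : Set E) : Prop :=
  ∀ n : ℕ, CnOn 𝕜 n f U

/-! ### Manifolds and Lie groups modelled on locally convex spaces -/

/-- The product of two charted spaces, with the product charts, modelled on `E × E'`. -/
instance prodCharted (E M E' M' : Type*) [TopologicalSpace E] [TopologicalSpace M]
    [ChartedSpace E M] [TopologicalSpace E'] [TopologicalSpace M'] [ChartedSpace E' M'] :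
    ChartedSpace (E × E') (M × M') :=
  prodChartedSpace E M E' M'

/-- The map `f` between charted spaces is smooth on the open set `s`: it is continuous on `s`
and smooth there in all charts. -/
def MSmoothOn (𝕜 E E' : Type*) [RCLike 𝕜] [AddCommGroup E] [Module 𝕜 E] [TopologicalSpace E]
    [AddCommGroup E'] [Module 𝕜 E'] [TopologicalSpace E'] {M M' : Type*}
    [tM : TopologicalSpace M] [cM : ChartedSpace E M]
    [tM' : TopologicalSpace M'] [cM' : ChartedSpace E' M'] (f : M → M') (s : Set M) : Prop :=
  ContinuousOn f s ∧ ∀ e ∈ atlas E M, ∀ e' ∈ atlas E' M',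
    SmoothOn 𝕜 (e' ∘ f ∘ e.symm) (e.target ∩ e.symm ⁻¹' (s ∩ f ⁻¹' e'.source))

/-- `f` is smooth. -/
def MSmooth (𝕜 E E' : Type*) [RCLike 𝕜] [AddCommGroup E] [Module 𝕜 E] [TopologicalSpace E]
    [AddCommGroup E'] [Module 𝕜 E'] [TopologicalSpace E'] {M M' : Type*}
    [tM : TopologicalSpace M] [cM : ChartedSpace E M]
    [tM' : TopologicalSpace M'] [cM' : ChartedSpace E' M'] (f : M → M') : Prop :=
  MSmoothOn 𝕜 E E' f univ

/-- `s` is open and `f` restricts to a diffeomorphism of `s` onto an open subset of `M'`. -/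
def IsOpenDiffeoOn (𝕜 E E' : Type*) [RCLike 𝕜] [AddCommGroup E] [Module 𝕜 E]
    [TopologicalSpace E] [AddCommGroup E'] [Module 𝕜 E'] [TopologicalSpace E'] {M M' : Type*}
    [tM : TopologicalSpace M] [cM : ChartedSpace E M]
    [tM' : TopologicalSpace M'] [cM' : ChartedSpace E' M'] (f : M → M') (s : Set M) : Prop :=
  IsOpen s ∧ IsOpen (f '' s) ∧ MSmoothOn 𝕜 E E' f s ∧
    ∃ g : M' → M, LeftInvOn g f s ∧ MSmoothOn 𝕜 E' E g (f '' s)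

/-- Smooth manifolds modelled on the locally convex space `E`: all chart changes of the atlas
are smooth. -/
class SmoothManifold (𝕜 E M : Type*) [RCLike 𝕜] [AddCommGroup E] [Module 𝕜 E]
    [TopologicalSpace E] [LocallyConvexTVS 𝕜 E] [TopologicalSpace M] [ChartedSpace E M] :
    Prop where
  compatible : ∀ e ∈ atlas E M, ∀ e' ∈ atlas E M,
    SmoothOn 𝕜 (e' ∘ e.symm) (e.target ∩ e.symm ⁻¹' e'.source)

/-- Lie groups modelled on the locally convex space `E`. -/
class LieGrp (𝕜 E G : Type*) [RCLike 𝕜] [AddCommGroup E] [Module 𝕜 E]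
    [TopologicalSpace E] [LocallyConvexTVS 𝕜 E] [Group G] [TopologicalSpace G]
    [ChartedSpace E G] : Prop extends SmoothManifold 𝕜 E G where
  smooth_mul : MSmooth 𝕜 (E × E) E (fun p : G × G => p.1 * p.2)
  smooth_inv : MSmooth 𝕜 E E (fun g : G => g⁻¹)

/-- A Lie group structure, modelled on `E`, on the abstract group `X`. -/
structure LieGrpStructure (𝕜 E X : Type*) [RCLike 𝕜] [AddCommGroup E] [Module 𝕜 E]
    [TopologicalSpace E] [LocallyConvexTVS 𝕜 E] [Group X] where
  top : TopologicalSpace X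
  charts : ChartedSpace E X
  lieGrp : LieGrp 𝕜 E X

/-- Two Lie group structures on `X` (possibly with different model spaces and atlases) are the
same if the identity map of `X` is a diffeomorphism between them. -/
def LieGrpStructure.Same {𝕜 E E' X : Type*} [RCLike 𝕜] [AddCommGroup E] [Module 𝕜 E]
    [TopologicalSpace E] [LocallyConvexTVS 𝕜 E] [AddCommGroup E'] [Module 𝕜 E']
    [TopologicalSpace E'] [LocallyConvexTVS 𝕜 E'] [Group X]
    (L : LieGrpStructure 𝕜 E X) (L' : LieGrpStructure 𝕜 E' X) : Prop :=
  MSmooth 𝕜 E E' (tM := L.top) (cM := L.charts) (tM' := L'.top) (cM' := L'.charts) (id : X → X) ∧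
  MSmooth 𝕜 E' E (tM := L'.top) (cM := L'.charts) (tM' := L.top) (cM' := L.charts) (id : X → X)

/-! ### Locally smooth cochains and factor systems -/

section Cochains

variable (𝕜 EG EN : Type*) [RCLike 𝕜]
  [AddCommGroup EG] [Module 𝕜 EG] [TopologicalSpace EG]
  [AddCommGroup EN] [Module 𝕜 EN] [TopologicalSpace EN]
  {G N : Type*} [Group G] [TopologicalSpace G] [ChartedSpace EG G]
  [Group N] [TopologicalSpace N] [ChartedSpace EN N]

/-- `f` is smooth on some open identity neighbourhood. -/
def SmoothNearOne (f : G → N) : Prop :=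
  ∃ U : Set G, IsOpen U ∧ 1 ∈ U ∧ MSmoothOn 𝕜 EG EN f U

/-- `C¹_s(G, N)`: normalized maps `G → N` that are smooth near the identity. -/
def IsC1s (f : G → N) : Prop :=
  f 1 = 1 ∧ SmoothNearOne 𝕜 EG EN f

/-- `C²_s(G, N)`: normalized maps `G × G → N` that are smooth near the identity. -/
def IsC2s (ω : G → G → N) : Prop :=
  (∀ g, ω g 1 = 1) ∧ (∀ g, ω 1 g = 1) ∧
    SmoothNearOne 𝕜 (EG × EG) EN (fun p : G × G => ω p.1 p.2)

/-- `C²_ss(G, N)`: those `ω ∈ C²_s(G, N)` for which each map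
`ω_g : x ↦ ω(g, x) ω(g x g⁻¹, g)⁻¹` is smooth near the identity. -/
def IsC2ss (ω : G → G → N) : Prop :=
  IsC2s 𝕜 EG EN ω ∧ ∀ g, SmoothNearOne 𝕜 EG EN (fun x => ω g x * (ω (g * x * g⁻¹) g)⁻¹)

/-- `C¹_s(G, Aut N)`: maps `S` from `G` to the Lie group automorphisms of `N` with `S 1 = id`
for which `(g, n) ↦ S(g)(n)` is smooth on `U × N` for some open identity neighbourhood `U`. -/
def IsC1sAut (S : G → MulAut N) : Prop :=
  (∀ g, MSmooth 𝕜 EN EN (S g) ∧ MSmooth 𝕜 EN EN (S g).symm) ∧ S 1 = 1 ∧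
    ∃ U : Set G, IsOpen U ∧ 1 ∈ U ∧
      MSmoothOn 𝕜 (EG × EN) EN (fun p : G × N => S p.1 p.2) (U ×ˢ univ)

end Cochains

/-- (Algebraic) factor systems: normalized pairs with `δ_S = C_N ∘ ω` and `d_S ω = 1`. -/
structure IsFactorSystem {G N : Type*} [Group G] [Group N]
    (S : G → MulAut N) (ω : G → G → N) : Prop where
  map_one : S 1 = 1
  right_one : ∀ g, ω g 1 = 1
  left_one : ∀ g, ω 1 g = 1
  delta_eq : ∀ g g', S g * S g' * (S (g * g'))⁻¹ = MulAut.conj (ω g g')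
  cocycle : ∀ g g' g'',
    S g (ω g' g'') * ω g (g' * g'') * (ω (g * g') g'')⁻¹ * (ω g g')⁻¹ = 1

/-- Smooth factor systems `(S, ω) ∈ Z²_ss(G, N)` for the pair `(G, N)`. -/
structure IsSmoothFactorSystem (𝕜 EG EN : Type*) [RCLike 𝕜]
    [AddCommGroup EG] [Module 𝕜 EG] [TopologicalSpace EG]
    [AddCommGroup EN] [Module 𝕜 EN] [TopologicalSpace EN]
    {G N : Type*} [Group G] [TopologicalSpace G] [ChartedSpace EG G]
    [Group N] [TopologicalSpace N] [ChartedSpace EN N]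
    (S : G → MulAut N) (ω : G → G → N) : Prop extends IsFactorSystem S ω where
  isC1sAut : IsC1sAut 𝕜 EG EN S
  isC2ss : IsC2ss 𝕜 EG EN ω

/-- The set `N × G`, to be endowed with the multiplication
`(n, g) (n', g') = (n S(g)(n') ω(g, g'), g g')`. -/
@[ext]
structure TwistedProduct {G N : Type*} [Group G] [Group N] {S : G → MulAut N} {ω : G → G → N}
    (h : IsFactorSystem S ω) where
  fst : N
  snd : G

namespace TwistedProduct

variable {G N : Type*} [Group G] [Group N] {S : G → MulAut N} {ω : G → G → N}
  {h : IsFactorSystem S ω}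

instance : Mul (TwistedProduct h) :=
  ⟨fun a b => ⟨a.fst * S a.snd b.fst * ω a.snd b.snd, a.snd * b.snd⟩⟩

instance : One (TwistedProduct h) := ⟨⟨1, 1⟩⟩

instance : Inv (TwistedProduct h) :=
  ⟨fun a => ⟨(ω a.snd⁻¹ a.snd)⁻¹ * S a.snd⁻¹ a.fst⁻¹, a.snd⁻¹⟩⟩

theorem mul_def (a b : TwistedProduct h) :
    a * b = ⟨a.fst * S a.snd b.fst * ω a.snd b.snd, a.snd * b.snd⟩ := rfl

theorem one_def : (1 : TwistedProduct h) = ⟨1, 1⟩ := rfl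

theorem inv_def (a : TwistedProduct h) :
    a⁻¹ = ⟨(ω a.snd⁻¹ a.snd)⁻¹ * S a.snd⁻¹ a.fst⁻¹, a.snd⁻¹⟩ := rfl

theorem aut_aut (h : IsFactorSystem S ω) (g g' : G) (n : N) :
    S g (S g' n) = ω g g' * S (g * g') n * (ω g g')⁻¹ := by
  have := h.delta_eq g g'
  rw [mul_inv_eq_iff_eq_mul] at this
  have := congrArg (fun φ : MulAut N => φ n) this
  simpa [MulAut.mul_apply, MulAut.conj_apply] using this

instance : Group (TwistedProduct h) :=
  Group.ofLeftAxioms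
    (by
      intro a b c
      have h1 := h.cocycle a.snd b.snd c.snd
      rw [mul_inv_eq_one, mul_inv_eq_iff_eq_mul] at h1
      have h2 := aut_aut h a.snd b.snd c.fst
      ext
      · simp only [mul_def, map_mul, h2]
        simp only [mul_assoc] at h1 ⊢
        simp [h1]
      · simp [mul_def, mul_assoc])
    (by
      intro a
      ext <;> simp [mul_def, one_def, h.map_one, h.left_one])
    (by
      intro a
      ext <;> simp [mul_def, one_def, inv_def, mul_assoc])

/-- The identity map `N × G → N ×_(S,ω) G`, `(n, g) ↦ (n, g)`. -/
def ofProd (h : IsFactorSystem S ω) (p : N × G) : TwistedProduct h := ⟨p.1, p.2⟩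

/-- The short exact sequence `1 → N → N ×_(S,ω) G → G → 1` with `n ↦ (n, 1)` and `(n, g) ↦ g`. -/
def extension (h : IsFactorSystem S ω) : GroupExtension N (TwistedProduct h) G where
  inl :=
    { toFun := fun n => ⟨n, 1⟩
      map_one' := rfl
      map_mul' := fun a b => by ext <;> simp [mul_def, h.map_one, h.left_one] }
  rightHom :=
    { toFun := fun a => a.snd
      map_one' := rfl
      map_mul' := fun _ _ => rfl }
  inl_injective := fun a b hab => congrArg TwistedProduct.fst hab
  range_inl_eq_ker_rightHom := by
    ext a
    constructor
    · rintro ⟨n, rfl⟩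
      rfl
    · intro ha
      exact ⟨a.fst, TwistedProduct.ext rfl (Eq.symm ha)⟩
  rightHom_surjective := fun g => ⟨⟨1, g⟩, rfl⟩

end TwistedProduct

/-! ### Extensions of Lie groups -/

section Extensions

variable (𝕜 EN EH EG : Type*) [RCLike 𝕜]
  [AddCommGroup EN] [Module 𝕜 EN] [TopologicalSpace EN]
  [AddCommGroup EH] [Module 𝕜 EH] [TopologicalSpace EH]
  [AddCommGroup EG] [Module 𝕜 EG] [TopologicalSpace EG]
  {N H G : Type*} [Group N] [TopologicalSpace N] [ChartedSpace EN N]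
  [Group H] [tH : TopologicalSpace H] [cH : ChartedSpace EH H]
  [Group G] [TopologicalSpace G] [ChartedSpace EG G]

/-- The short exact sequence `1 → N → H → G → 1` is an extension of Lie groups: `ι : N → H` and
`q : H → G` are smooth and `q` is a locally trivial smooth `N`-principal bundle (for the right
action of `N` on `H`), i.e. near every point of `G` there are an open set `U` and a section `s`
of `q` over `U` for which the `N`-equivariant map `U × N → q⁻¹(U)`, `(x, n) ↦ s(x) ι(n)`,
is a diffeomorphism. -/
structure IsLieExtension (ext : GroupExtension N H G) : Prop where
  smooth_inl : MSmooth 𝕜 EN EH ext.inl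
  smooth_rightHom : MSmooth 𝕜 EH EG ext.rightHom
  locally_trivial : ∀ g : G, ∃ U : Set G, IsOpen U ∧ g ∈ U ∧ ∃ s : G → H,
    (∀ x ∈ U, ext.rightHom (s x) = x) ∧
    IsOpenDiffeoOn 𝕜 (EG × EN) EH (fun p : G × N => s p.1 * ext.inl p.2) (U ×ˢ univ)

end Extensions

/-- Equivalence of Lie group extensions `N → H → G` and `N → H' → G`: there is an isomorphism of
Lie groups `H → H'` which commutes with the maps from `N` and the maps to `G`. -/
def LieEquivalent (𝕜 EH EH' : Type*) [RCLike 𝕜]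
    [AddCommGroup EH] [Module 𝕜 EH] [TopologicalSpace EH]
    [AddCommGroup EH'] [Module 𝕜 EH'] [TopologicalSpace EH']
    {N H H' G : Type*} [Group N] [Group G]
    [Group H] [tH : TopologicalSpace H] [cH : ChartedSpace EH H]
    [Group H'] [tH' : TopologicalSpace H'] [cH' : ChartedSpace EH' H']
    (ext : GroupExtension N H G) (ext' : GroupExtension N H' G) : Prop :=
  ∃ φ : ext.Equiv ext', MSmooth 𝕜 EH EH' φ ∧ MSmooth 𝕜 EH' EH φ.symm

section SectionCocycle

variable {N H G : Type*} [Group N] [Group H] [Group G] {ext : GroupExtension N H G}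

/-- `C_N ∘ σ : G → Aut(N)`, where `C_N` is the conjugation action of `H` on `N`. -/
noncomputable def sectionAct (σ : ext.Section) (g : G) : MulAut N := ext.conjAct (σ g)

theorem exists_inl_eq (σ : ext.Section) (g g' : G) :
    ∃ n : N, ext.inl n = σ g * σ g' * (σ (g * g'))⁻¹ := by
  rw [← MonoidHom.mem_range, ext.range_inl_eq_ker_rightHom, MonoidHom.mem_ker]
  simp

/-- `δ_σ(g, g') = σ(g) σ(g') σ(g g')⁻¹`, as an element of `N`. -/
noncomputable def sectionCocycle (σ : ext.Section) (g g' : G) : N :=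
  Classical.choose (exists_inl_eq σ g g')

theorem inl_sectionCocycle (σ : ext.Section) (g g' : G) :
    ext.inl (sectionCocycle σ g g') = σ g * σ g' * (σ (g * g'))⁻¹ :=
  Classical.choose_spec (exists_inl_eq σ g g')

end SectionCocycle

/-! ### Lie group structures on `N ×_(S,ω) G` -/

section Structures

variable {𝕜 E G N : Type*} [RCLike 𝕜]
  [AddCommGroup E] [Module 𝕜 E] [TopologicalSpace E] [LocallyConvexTVS 𝕜 E]
  [Group G] [TopologicalSpace G] [Group N] [TopologicalSpace N]
  {S : G → MulAut N} {ω : G → G → N} {h : IsFactorSystem S ω}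

/-- For some open identity neighbourhood `U` of `G`, the identity map
`N × G → N ×_(S,ω) G` restricts to a diffeomorphism of `N × U` onto an open subset. -/
def IsDiffeoOnStrip (EN EG : Type*)
    [AddCommGroup EG] [Module 𝕜 EG] [TopologicalSpace EG] [ChartedSpace EG G]
    [AddCommGroup EN] [Module 𝕜 EN] [TopologicalSpace EN] [ChartedSpace EN N]
    (L : LieGrpStructure 𝕜 E (TwistedProduct h)) : Prop :=
  ∃ U : Set G, IsOpen U ∧ 1 ∈ U ∧
    IsOpenDiffeoOn 𝕜 (EN × EG) E (tM' := L.top) (cM' := L.charts)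
      (TwistedProduct.ofProd h) (univ ×ˢ U)

/-- For some open identity neighbourhood `U` of `G`, the identity map
`N × G → N ×_(S,ω) G` is smooth on `N × U`. -/
def IsSmoothOnStrip (EN EG : Type*)
    [AddCommGroup EG] [Module 𝕜 EG] [TopologicalSpace EG] [ChartedSpace EG G]
    [AddCommGroup EN] [Module 𝕜 EN] [TopologicalSpace EN] [ChartedSpace EN N]
    (L : LieGrpStructure 𝕜 E (TwistedProduct h)) : Prop :=
  ∃ U : Set G, IsOpen U ∧ 1 ∈ U ∧
    MSmoothOn 𝕜 (EN × EG) E (tM' := L.top) (cM' := L.charts)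
      (TwistedProduct.ofProd h) (univ ×ˢ U)

/-- With the Lie group structure `L`, the sequence `N → N ×_(S,ω) G → G` is an extension of
Lie groups. -/
def IsExtensionWith (EN EG : Type*)
    [AddCommGroup EG] [Module 𝕜 EG] [TopologicalSpace EG] [ChartedSpace EG G]
    [AddCommGroup EN] [Module 𝕜 EN] [TopologicalSpace EN] [ChartedSpace EN N]
    (L : LieGrpStructure 𝕜 E (TwistedProduct h)) : Prop :=
  IsLieExtension 𝕜 EN E EG (tH := L.top) (cH := L.charts) (TwistedProduct.extension h)

end Structures

end LCLie

open LCLie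

set_option linter.unusedSectionVars false

/-! A Lie group structure is determined by its germ at the identity: since `φ x = φ a * φ (a⁻¹ *
x)`, a homomorphism smooth near `1` is smooth (`mSmooth_of_hom`). Two structures for which `N × U`
is an open strip therefore agree, because the identity map is a local diffeomorphism at `1`.

For existence, left translates of a thin strip `N × W` serve as charts. A chart change is left
multiplication by some `c`, applied where both `p.2` and `c.snd * p.2` lie in `W`. This forces
`c.snd ∈ W * W⁻¹`, so only the smooth parts of `S` and `ω` enter. Left translations are then smooth
by construction, products and inverses are smooth near `1`, and it remains to control conjugation
near `1` (`LieGrp.of_local`). By `ofProd_conj`, this is what the condition on `ω g x * (ω (g * x *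
g⁻¹) g)⁻¹` provides.

For an extension, the kernel inclusion `ι` is initial for smooth maps
(`IsLieExtension.mSmoothAt_of_inl`), because `n` is a coordinate of `s 1 * ι n` in a local
trivialization. A map into `N` can thus be tested in the middle group, where `S`, `ω` and the
`N`-component become products of values of `σ` and `ι`. This yields the smooth factor system of a
section, the equivalence with the twisted product, and the second uniqueness statement.

All of this rests on the chain rule for `C^n` maps, which is derived from a mean value argument in
locally convex spaces. -/

namespace LCLie

/-! ### Differential calculus: locality and the chain rule. -/

section Calculus

universe u v w

variable {𝕜 : Type*} [RCLike 𝕜]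

theorem eventually_add_smul_mem {E : Type*} [AddCommGroup E] [Module 𝕜 E] [TopologicalSpace E]
    [LocallyConvexTVS 𝕜 E] {U : Set E} (hU : IsOpen U) {x : E} (hx : x ∈ U) (h : E) :
    ∀ᶠ t : 𝕜 in 𝓝 0, x + t • h ∈ U := by
  have : ContinuousAt (fun t : 𝕜 => x + t • h) 0 := by fun_prop
  exact this.eventually_mem (hU.mem_nhds (by simpa using hx))

theorem HasDirDeriv.congr {E F : Type*} [AddCommGroup E] [Module 𝕜 E] [TopologicalSpace E]
    [LocallyConvexTVS 𝕜 E] [AddCommGroup F] [Module 𝕜 F] [TopologicalSpace F] {f g : E → F}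
    {U : Set E} (hU : IsOpen U) (hfg : EqOn f g U) {x h : E} (hx : x ∈ U) {y : F}
    (hf : HasDirDeriv 𝕜 f x h y) : HasDirDeriv 𝕜 g x h y := by
  refine Tendsto.congr' ?_ hf
  filter_upwards [(eventually_add_smul_mem hU hx h).filter_mono nhdsWithin_le_nhds] with t ht
  rw [hfg ht, hfg hx]

section

variable {F : Type v} [AddCommGroup F] [Module 𝕜 F] [TopologicalSpace F]

theorem CnOn.continuousOn {n : ℕ} {E : Type u} [AddCommGroup E] [Module 𝕜 E]
    [TopologicalSpace E] {f : E → F} {U : Set E} (hf : CnOn 𝕜 n f U) : ContinuousOn f U := by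
  cases n with
  | zero => exact hf
  | succ n => exact hf.1

theorem CnOn.mono {n : ℕ} : ∀ {E : Type u} [AddCommGroup E] [Module 𝕜 E]
    [TopologicalSpace E] {f : E → F} {U V : Set E}, CnOn 𝕜 n f U → V ⊆ U → CnOn 𝕜 n f V := by
  induction n with
  | zero => intro E _ _ _ f U V hf hV; exact ContinuousOn.mono hf hV
  | succ n ih =>
    rintro E _ _ _ f U V ⟨hc, df, hd, hdf⟩ hV
    exact ⟨hc.mono hV, df, fun x hx => hd x (hV hx), ih hdf (prod_mono hV subset_rfl)⟩

theorem CnOn.of_succ {n : ℕ} : ∀ {E : Type u} [AddCommGroup E] [Module 𝕜 E]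
    [TopologicalSpace E] {f : E → F} {U : Set E}, CnOn 𝕜 (n + 1) f U → CnOn 𝕜 n f U := by
  induction n with
  | zero => intro E _ _ _ f U hf; exact hf.1
  | succ n ih =>
    rintro E _ _ _ f U ⟨hc, df, hd, hdf⟩
    exact ⟨hc, df, hd, ih hdf⟩

theorem CnOn.congr {n : ℕ} {E : Type u} [AddCommGroup E] [Module 𝕜 E]
    [TopologicalSpace E] [LocallyConvexTVS 𝕜 E] {f g : E → F} {U : Set E} (hf : CnOn 𝕜 n f U)
    (hU : IsOpen U) (hfg : EqOn f g U) : CnOn 𝕜 n g U := by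
  cases n with
  | zero => exact ContinuousOn.congr hf hfg.symm
  | succ n =>
    obtain ⟨hc, df, hd, hdf⟩ := hf
    exact ⟨hc.congr hfg.symm, df, fun x hx h => (hd x hx h).congr hU hfg hx, hdf⟩

/-- For a linear inner map the difference quotients match on the nose, so no mean value argument is
needed. The chain rule itself uses this to see `f ∘ fst` as a `C^n` map. -/
theorem CnOn.comp_clm {n : ℕ} : ∀ {E : Type u} {E' : Type w} [AddCommGroup E] [Module 𝕜 E]
    [TopologicalSpace E] [AddCommGroup E'] [Module 𝕜 E'] [TopologicalSpace E'] {f : E → F}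
    {U : Set E}, CnOn 𝕜 n f U → ∀ A : E' →L[𝕜] E, CnOn 𝕜 n (f ∘ A) (A ⁻¹' U) := by
  induction n with
  | zero =>
    intro E E' _ _ _ _ _ _ f U hf A
    exact ContinuousOn.comp hf A.continuous.continuousOn (mapsTo_preimage _ _)
  | succ n ih =>
    rintro E E' _ _ _ _ _ _ f U ⟨hc, df, hd, hdf⟩ A
    refine ⟨hc.comp A.continuous.continuousOn (mapsTo_preimage _ _), df ∘ A.prodMap A, ?_, ?_⟩
    · intro x hx h
      have := hd (A x) hx (A h)
      simpa [HasDirDeriv, Function.comp_def] using this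
    · exact (ih hdf (A.prodMap A)).mono fun p hp => ⟨hp.1, mem_univ _⟩

theorem CnOn.prodMk {n : ℕ} {F' : Type w} [AddCommGroup F'] [Module 𝕜 F'] [TopologicalSpace F'] :
    ∀ {E : Type u} [AddCommGroup E] [Module 𝕜 E] [TopologicalSpace E] {f : E → F} {g : E → F'}
    {U : Set E}, CnOn 𝕜 n f U → CnOn 𝕜 n g U → CnOn 𝕜 n (fun x => (f x, g x)) U := by
  induction n with
  | zero => intro E _ _ _ f g U hf hg; exact ContinuousOn.prodMk hf hg
  | succ n ih =>
    rintro E _ _ _ f g U ⟨hc, df, hd, hdf⟩ ⟨hc', dg, hd', hdg⟩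
    refine ⟨hc.prodMk hc', fun p => (df p, dg p), fun x hx h => ?_, ih hdf hdg⟩
    exact Tendsto.prodMk_nhds (hd x hx h) (hd' x hx h)

theorem cnOn_const {n : ℕ} : ∀ {E : Type u} [AddCommGroup E] [Module 𝕜 E]
    [TopologicalSpace E] (c : F) (U : Set E), CnOn 𝕜 n (fun _ => c) U := by
  induction n with
  | zero => intro E _ _ _ c U; exact continuousOn_const
  | succ n ih =>
    intro E _ _ _ c U
    refine ⟨continuousOn_const, fun _ => 0, fun x _ h => ?_, ih 0 _⟩
    simpa [HasDirDeriv] using tendsto_const_nhds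

/-- The local hypotheses supply unrelated derivative functions. Taking `limUnder` of the difference
quotient gives one global candidate, and uniqueness of limits in a Hausdorff space makes it agree
with each local one. -/
theorem CnOn.of_local {n : ℕ} [T2Space F] : ∀ {E : Type u} [AddCommGroup E] [Module 𝕜 E]
    [TopologicalSpace E] [LocallyConvexTVS 𝕜 E] {f : E → F} {U : Set E},
    (∀ x ∈ U, ∃ V, IsOpen V ∧ x ∈ V ∧ CnOn 𝕜 n f V) → CnOn 𝕜 n f U := by
  induction n with
  | zero =>
    intro E _ _ _ _ f U H x hx
    obtain ⟨V, hV, hxV, hf⟩ := H x hx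
    exact (ContinuousOn.continuousAt hf (hV.mem_nhds hxV)).continuousWithinAt
  | succ n ih =>
    intro E _ _ _ _ f U H
    have H' : ∀ x ∈ U, ∀ h, ∃ y, HasDirDeriv 𝕜 f x h y := by
      intro x hx h
      obtain ⟨V, hV, hxV, hc, df, hd, -⟩ := H x hx
      exact ⟨_, hd x hxV h⟩
    refine ⟨fun x hx => ?_, fun p => limUnder (𝓝[≠] (0 : 𝕜))
      (fun t : 𝕜 => t⁻¹ • (f (p.1 + t • p.2) - f p.1)), fun x hx h => ?_, ih ?_⟩
    · obtain ⟨V, hV, hxV, hf⟩ := H x hx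
      exact (hf.continuousOn.continuousAt (hV.mem_nhds hxV)).continuousWithinAt
    · exact tendsto_nhds_limUnder (H' x hx h)
    · rintro ⟨x, h⟩ ⟨hx, -⟩
      obtain ⟨V, hV, hxV, hc, dg, hd, hdg⟩ := H x hx
      refine ⟨V ×ˢ univ, hV.prod isOpen_univ, ⟨hxV, mem_univ _⟩,
        hdg.congr (hV.prod isOpen_univ) ?_⟩
      rintro ⟨y, k⟩ ⟨hy, -⟩
      exact (Tendsto.limUnder_eq (hd y hy k)).symm

end

/-- The direction may vary with `t`, which is what the chain rule needs. Morally the quotient is an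
average of `df` over a segment, hence lies in any convex set containing those values. Integrals are
avoided: if the quotient missed the interior of `C`, a functional would separate it from that
interior, contradicting the scalar mean value theorem. -/
theorem tendsto_differenceQuotient {E F : Type*} [AddCommGroup E] [Module 𝕜 E]
    [TopologicalSpace E] [LocallyConvexTVS 𝕜 E] [AddCommGroup F] [Module 𝕜 F]
    [TopologicalSpace F] [LocallyConvexTVS 𝕜 F] {f : E → F} {df : E × E → F} {U : Set E}
    (hU : IsOpen U) (hd : ∀ x ∈ U, ∀ h, HasDirDeriv 𝕜 f x h (df (x, h)))
    (hc : ContinuousOn df (U ×ˢ univ)) {x h : E} (hx : x ∈ U) {k : 𝕜 → E}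
    (hk : Tendsto k (𝓝[≠] 0) (𝓝 h)) :
    Tendsto (fun t => t⁻¹ • (f (x + t • k t) - f x)) (𝓝[≠] 0) (𝓝 (df (x, h))) := by
  let : Module ℝ F := Module.compHom F (algebraMap ℝ 𝕜)
  have : LocallyConvexSpace ℝ F := LocallyConvexTVS.locallyConvex (𝕜 := 𝕜)
  have : IsScalarTower ℝ 𝕜 F := ⟨fun r c y => by
    rw [RCLike.real_smul_eq_coe_mul, mul_smul]; rfl⟩
  have : ContinuousSMul ℝ F := IsScalarTower.continuousSMul (M := ℝ) (α := F) 𝕜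
  rw [(LocallyConvexSpace.convex_basis (𝕜 := ℝ) (df (x, h))).tendsto_right_iff]
  rintro C ⟨hC, hCc⟩
  have hV : interior C ∈ 𝓝 (df (x, h)) := interior_mem_nhds.2 hC
  have hVc : Convex ℝ (interior C) := hCc.interior
  have hU2 : IsOpen (U ×ˢ (univ : Set E)) := hU.prod isOpen_univ
  have hx2 : ((x, h) : E × E) ∈ U ×ˢ (univ : Set E) := ⟨hx, mem_univ _⟩
  have hW : ∀ᶠ p : E × E in 𝓝 (x, h), p.1 ∈ U ∧ df p ∈ interior C := by
    filter_upwards [hU2.mem_nhds hx2, (hc.continuousAt (hU2.mem_nhds hx2)).eventually_mem hV]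
      with p hp hp' using ⟨hp.1, hp'⟩
  have hcont : Tendsto (fun p : 𝕜 × E => (x + p.1 • p.2, p.2)) (𝓝 (0, h)) (𝓝 (x, h)) := by
    have : Continuous (fun p : 𝕜 × E => (x + p.1 • p.2, p.2)) := by fun_prop
    simpa using this.tendsto (0, h)
  -- A product neighbourhood, with a ball in the `𝕜` factor, handles all points `x + (s * t) • k t`
  -- with `s ∈ [0, 1]` at once.
  have hW' := hcont.eventually hW
  rw [nhds_prod_eq] at hW'
  obtain ⟨P, hP, K, hK, hPK⟩ := Filter.eventually_prod_iff.1 hW'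
  obtain ⟨ε, hε, hPε⟩ := Metric.eventually_nhds_iff_ball.1 hP
  have hball : ∀ᶠ t : 𝕜 in 𝓝[≠] 0, t ∈ Metric.ball (0 : 𝕜) ε :=
    mem_nhdsWithin_of_mem_nhds (Metric.ball_mem_nhds _ hε)
  filter_upwards [hk.eventually hK, hball, self_mem_nhdsWithin] with t htK htε ht0
  have ht0 : t ≠ 0 := ht0
  apply interior_subset
  by_contra hnot
  obtain ⟨l, hl⟩ := RCLike.geometric_hahn_banach_open_point (𝕜 := 𝕜) hVc isOpen_interior hnot
  have key : ∀ s ∈ Icc (0 : ℝ) 1, x + ((s : 𝕜) * t) • k t ∈ U ∧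
      df (x + ((s : 𝕜) * t) • k t, k t) ∈ interior C := by
    intro s hs
    refine hPK (hPε _ ?_) htK
    rw [mem_ball_zero_iff] at htε ⊢
    rw [norm_mul, RCLike.norm_ofReal, abs_of_nonneg hs.1]
    exact (mul_le_of_le_one_left (norm_nonneg _) hs.2).trans_lt htε
  have hder : ∀ s ∈ Icc (0 : ℝ) 1, HasDerivAt
      (fun s : ℝ => RCLike.re (l (t⁻¹ • f (x + ((s : 𝕜) * t) • k t))))
      (RCLike.re (l (df (x + ((s : 𝕜) * t) • k t, k t)))) s := by
    intro s hs
    rw [hasDerivAt_iff_tendsto_slope_zero]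
    have h1 := hd _ (key s hs).1 (k t)
    -- A real increment `r` of `s` is the increment `r * t` along `k t`; the prefactor `t⁻¹` removes
    -- the resulting factor `t`.
    have h2 : Tendsto (fun r : ℝ => (r : 𝕜) * t) (𝓝[≠] 0) (𝓝[≠] 0) := by
      refine tendsto_nhdsWithin_iff.2 ⟨?_, ?_⟩
      · have : Continuous (fun r : ℝ => (r : 𝕜) * t) := by fun_prop
        simpa using (this.tendsto 0).mono_left nhdsWithin_le_nhds
      · filter_upwards [self_mem_nhdsWithin] with r hr
        have hr : r ≠ 0 := hr
        simp [hr, ht0]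
    have h3 := ((RCLike.continuous_re (K := 𝕜)).comp l.continuous).continuousAt.tendsto.comp
      (Tendsto.comp h1 h2)
    refine h3.congr fun r => ?_
    have e : x + (((s + r : ℝ) : 𝕜) * t) • k t =
        x + ((s : 𝕜) * t) • k t + ((r : 𝕜) * t) • k t := by
      push_cast
      rw [add_mul, add_smul, add_assoc]
    simp only [Function.comp_apply, e]
    rw [← map_sub, ← map_sub, ← smul_sub, mul_inv, mul_smul, map_smul, smul_eq_mul,
      ← RCLike.ofReal_inv, RCLike.re_ofReal_mul, smul_eq_mul]
  obtain ⟨s, hs, hs'⟩ := exists_hasDerivAt_eq_slope _ _ zero_lt_one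
    (fun s hs => (hder s hs).continuousAt.continuousWithinAt)
    (fun s hs => hder s (Ioo_subset_Icc_self hs))
  have := hl _ (key s (Ioo_subset_Icc_self hs)).2
  rw [hs'] at this
  simp [smul_sub] at this

/-- Write `f (x + t • h) = f x + t • k t`, where `k t` is the difference quotient of `f`. As `k t`
tends to `df (x, h)`, the previous lemma gives the derivative `dg (f x, df (x, h))`. This is again a
composite of maps one order lower, on other spaces, so the induction quantifies over the spaces. -/
theorem CnOn.comp {n : ℕ} : ∀ {E : Type u} {F : Type v} {K : Type w}
    [AddCommGroup E] [Module 𝕜 E] [TopologicalSpace E] [LocallyConvexTVS 𝕜 E]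
    [AddCommGroup F] [Module 𝕜 F] [TopologicalSpace F] [LocallyConvexTVS 𝕜 F]
    [AddCommGroup K] [Module 𝕜 K] [TopologicalSpace K] [LocallyConvexTVS 𝕜 K]
    {g : F → K} {f : E → F} {V : Set F} {U : Set E}, CnOn 𝕜 n g V → CnOn 𝕜 n f U →
    IsOpen V → IsOpen U → MapsTo f U V → CnOn 𝕜 n (g ∘ f) U := by
  induction n with
  | zero =>
    intro E F K _ _ _ _ _ _ _ _ _ _ _ _ g f V U hg hf hV hU hfU
    exact ContinuousOn.comp hg hf hfU
  | succ n ih =>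
    intro E F K _ _ _ _ _ _ _ _ _ _ _ _ g f V U hg hf hV hU hfU
    have hf' := hf.of_succ
    obtain ⟨hgc, dg, hdg, hdg'⟩ := hg
    obtain ⟨hfc, df, hdf, hdf'⟩ := hf
    refine ⟨hgc.comp hfc hfU, dg ∘ fun p => (f p.1, df p), fun x hx h => ?_, ?_⟩
    · have h1 := tendsto_differenceQuotient hV hdg hdg'.continuousOn (hfU hx) (hdf x hx h)
      refine h1.congr' ?_
      filter_upwards [self_mem_nhdsWithin] with t ht
      have ht : t ≠ 0 := ht
      simp [smul_smul, ht]
    · refine ih hdg' (CnOn.prodMk ?_ hdf') (hV.prod isOpen_univ) (hU.prod isOpen_univ)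
        fun p hp => ⟨hfU hp.1, mem_univ _⟩
      exact (hf'.comp_clm (ContinuousLinearMap.fst 𝕜 E E)).mono fun p hp => hp.1

end Calculus

/-! ### Smooth maps between locally convex spaces. -/

section SmoothOn

variable {𝕜 : Type*} [RCLike 𝕜] {E F K : Type*}
  [AddCommGroup E] [Module 𝕜 E] [TopologicalSpace E] [LocallyConvexTVS 𝕜 E]
  [AddCommGroup F] [Module 𝕜 F] [TopologicalSpace F] [LocallyConvexTVS 𝕜 F]
  [AddCommGroup K] [Module 𝕜 K] [TopologicalSpace K] [LocallyConvexTVS 𝕜 K]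

theorem SmoothOn.mono {f : E → F} {U V : Set E} (hf : SmoothOn 𝕜 f U) (h : V ⊆ U) :
    SmoothOn 𝕜 f V := fun n => (hf n).mono h

theorem SmoothOn.congr {f g : E → F} {U : Set E} (hf : SmoothOn 𝕜 f U) (hU : IsOpen U)
    (h : EqOn f g U) : SmoothOn 𝕜 g U := fun n => (hf n).congr hU h

theorem SmoothOn.prodMk {f : E → F} {g : E → K} {U : Set E} (hf : SmoothOn 𝕜 f U)
    (hg : SmoothOn 𝕜 g U) : SmoothOn 𝕜 (fun x => (f x, g x)) U := fun n => (hf n).prodMk (hg n)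

theorem SmoothOn.of_local {f : E → F} {U : Set E}
    (h : ∀ x ∈ U, ∃ V, IsOpen V ∧ x ∈ V ∧ SmoothOn 𝕜 f V) : SmoothOn 𝕜 f U := fun n =>
  CnOn.of_local fun x hx => let ⟨V, hV, hxV, hf⟩ := h x hx; ⟨V, hV, hxV, hf n⟩

theorem SmoothOn.comp {g : F → K} {f : E → F} {V : Set F} {U : Set E} (hg : SmoothOn 𝕜 g V)
    (hf : SmoothOn 𝕜 f U) (hV : IsOpen V) (hU : IsOpen U) (h : MapsTo f U V) :
    SmoothOn 𝕜 (g ∘ f) U := fun n => (hg n).comp (hf n) hV hU h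

theorem SmoothOn.comp_clm {f : F → K} {U : Set F} (hf : SmoothOn 𝕜 f U) (A : E →L[𝕜] F) :
    SmoothOn 𝕜 (f ∘ A) (A ⁻¹' U) := fun n => (hf n).comp_clm A

end SmoothOn

/-! ### Smooth maps between manifolds. -/

section Manifolds

variable {𝕜 E E' E'' : Type*} [RCLike 𝕜]
  [AddCommGroup E] [Module 𝕜 E] [TopologicalSpace E] [LocallyConvexTVS 𝕜 E]
  [AddCommGroup E'] [Module 𝕜 E'] [TopologicalSpace E'] [LocallyConvexTVS 𝕜 E']
  [AddCommGroup E''] [Module 𝕜 E''] [TopologicalSpace E''] [LocallyConvexTVS 𝕜 E'']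
  {M M' M'' : Type*} [TopologicalSpace M] [ChartedSpace E M]
  [TopologicalSpace M'] [ChartedSpace E' M'] [TopologicalSpace M''] [ChartedSpace E'' M'']

theorem MSmoothOn.mono {f : M → M'} {s t : Set M} (hf : MSmoothOn 𝕜 E E' f s) (h : t ⊆ s) :
    MSmoothOn 𝕜 E E' f t :=
  ⟨hf.1.mono h, fun e he e' he' => (hf.2 e he e' he').mono fun _ hx => ⟨hx.1, h hx.2.1, hx.2.2⟩⟩

theorem isOpen_chart_domain {f : M → M'} {s : Set M} (hs : IsOpen s) (hf : ContinuousOn f s)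
    (e : OpenPartialHomeomorph M E) (e' : OpenPartialHomeomorph M' E') :
    IsOpen (e.target ∩ e.symm ⁻¹' (s ∩ f ⁻¹' e'.source)) :=
  e.isOpen_inter_preimage_symm (hf.isOpen_inter_preimage hs e'.open_source)

theorem MSmoothOn.congr {f g : M → M'} {s : Set M} (hf : MSmoothOn 𝕜 E E' f s) (hs : IsOpen s)
    (h : EqOn f g s) : MSmoothOn 𝕜 E E' g s := by
  refine ⟨hf.1.congr h.symm, fun e he e' he' => ?_⟩
  have hset : e.target ∩ e.symm ⁻¹' (s ∩ g ⁻¹' e'.source) =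
      e.target ∩ e.symm ⁻¹' (s ∩ f ⁻¹' e'.source) := by
    ext y
    simp only [mem_inter_iff, mem_preimage]
    constructor <;> rintro ⟨h1, h2, h3⟩ <;> simpa [h1, h2, h h2] using h3
  rw [hset]
  exact (hf.2 e he e' he').congr (isOpen_chart_domain hs hf.1 e e') fun y hy => by
    simp [h hy.2.1]

theorem MSmoothOn.of_local {f : M → M'} {s : Set M}
    (h : ∀ x ∈ s, ∃ V, IsOpen V ∧ x ∈ V ∧ MSmoothOn 𝕜 E E' f V) : MSmoothOn 𝕜 E E' f s := by
  refine ⟨fun x hx => ?_, fun e he e' he' => SmoothOn.of_local fun y hy => ?_⟩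
  · obtain ⟨V, hV, hxV, hf⟩ := h x hx
    exact (hf.1.continuousAt (hV.mem_nhds hxV)).continuousWithinAt
  · obtain ⟨V, hV, hxV, hf⟩ := h _ hy.2.1
    exact ⟨_, isOpen_chart_domain hV hf.1 e e', ⟨hy.1, hxV, hy.2.2⟩, hf.2 e he e' he'⟩

theorem MSmoothOn.comp {g : M' → M''} {f : M → M'} {t : Set M'} {s : Set M}
    (hg : MSmoothOn 𝕜 E' E'' g t) (hf : MSmoothOn 𝕜 E E' f s) (ht : IsOpen t) (hs : IsOpen s)
    (h : MapsTo f s t) : MSmoothOn 𝕜 E E'' (g ∘ f) s := by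
  have hc : ContinuousOn (g ∘ f) s := hg.1.comp hf.1 h
  refine ⟨hc, fun e he e'' he'' => SmoothOn.of_local fun y hy => ?_⟩
  -- A single intermediate chart covers the composite only near `y`, hence the localization.
  let e' := chartAt E' (f (e.symm y))
  have he' : e' ∈ atlas E' M' := chart_mem_atlas _ _
  have h1 := isOpen_chart_domain hs hf.1 e e'
  have h2 := isOpen_chart_domain hs hc e e''
  refine ⟨_, h1.inter h2, ⟨⟨hy.1, hy.2.1, mem_chart_source _ _⟩, hy⟩, ?_⟩
  refine ((hg.2 e' he' e'' he'').comp ((hf.2 e he e' he').mono inter_subset_left)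
    (isOpen_chart_domain ht hg.1 e' e'') (h1.inter h2) ?_).congr (h1.inter h2) ?_
  · rintro z ⟨⟨-, hz, hz'⟩, -, -, hz''⟩
    have : e'.symm (e' (f (e.symm z))) = f (e.symm z) := e'.left_inv hz'
    refine ⟨e'.map_source hz', ?_, ?_⟩
    · simpa [this] using h hz
    · simpa [this] using hz''
  · rintro z ⟨⟨-, hz, hz'⟩, -, -, hz''⟩
    have : e'.symm (e' (f (e.symm z))) = f (e.symm z) := e'.left_inv hz'
    simp [this]

theorem MSmoothOn.prodMk {f : M → M'} {g : M → M''} {s : Set M} (hf : MSmoothOn 𝕜 E E' f s)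
    (hg : MSmoothOn 𝕜 E E'' g s) : MSmoothOn 𝕜 E (E' × E'') (fun x => (f x, g x)) s := by
  refine ⟨hf.1.prodMk hg.1, ?_⟩
  rintro e he _ ⟨e', he', e'', he'', rfl⟩
  exact ((hf.2 e he e' he').mono fun y hy => ⟨hy.1, hy.2.1, hy.2.2.1⟩).prodMk
    ((hg.2 e he e'' he'').mono fun y hy => ⟨hy.1, hy.2.1, hy.2.2.2⟩)

theorem mSmoothOn_id [SmoothManifold 𝕜 E M] (s : Set M) : MSmoothOn 𝕜 E E (id : M → M) s :=
  ⟨continuousOn_id, fun e he e' he' =>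
    (SmoothManifold.compatible e he e' he').mono fun _ hy => ⟨hy.1, hy.2.2⟩⟩

theorem mSmoothOn_const (c : M') (s : Set M) : MSmoothOn 𝕜 E E' (fun _ : M => c) s :=
  ⟨continuousOn_const, fun _ _ e' _ n => show CnOn 𝕜 n (fun _ => e' c) _ from cnOn_const _ _⟩

theorem mSmoothOn_fst [SmoothManifold 𝕜 E M] (s : Set (M × M')) :
    MSmoothOn 𝕜 (E × E') E (Prod.fst : M × M' → M) s := by
  refine ⟨continuousOn_fst, ?_⟩
  rintro _ ⟨e, he, e', he', rfl⟩ e₁ he₁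
  exact ((SmoothManifold.compatible (𝕜 := 𝕜) e he e₁ he₁).comp_clm
    (ContinuousLinearMap.fst 𝕜 E E')).mono fun y hy => ⟨hy.1.1, hy.2.2⟩

theorem mSmoothOn_snd [SmoothManifold 𝕜 E' M'] (s : Set (M × M')) :
    MSmoothOn 𝕜 (E × E') E' (Prod.snd : M × M' → M') s := by
  refine ⟨continuousOn_snd, ?_⟩
  rintro _ ⟨e, he, e', he', rfl⟩ e₁ he₁
  exact ((SmoothManifold.compatible (𝕜 := 𝕜) e' he' e₁ he₁).comp_clm
    (ContinuousLinearMap.snd 𝕜 E E')).mono fun y hy => ⟨hy.1.2, hy.2.2⟩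

instance [SmoothManifold 𝕜 E M] [SmoothManifold 𝕜 E' M'] :
    SmoothManifold 𝕜 (E × E') (M × M') where
  compatible := by
    rintro _ ⟨e, he, e', he', rfl⟩ _ ⟨e₁, he₁, e₁', he₁', rfl⟩
    exact (((SmoothManifold.compatible (𝕜 := 𝕜) e he e₁ he₁).comp_clm
      (ContinuousLinearMap.fst 𝕜 E E')).mono fun y hy => ⟨hy.1.1, hy.2.1⟩).prodMk
      (((SmoothManifold.compatible (𝕜 := 𝕜) e' he' e₁' he₁').comp_clm
      (ContinuousLinearMap.snd 𝕜 E E')).mono fun y hy => ⟨hy.1.2, hy.2.2⟩)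

/-- `f` is smooth on some open neighbourhood of `x`. -/
def MSmoothAt (𝕜 E E' : Type*) [RCLike 𝕜] [AddCommGroup E] [Module 𝕜 E] [TopologicalSpace E]
    [AddCommGroup E'] [Module 𝕜 E'] [TopologicalSpace E'] {M M' : Type*}
    [TopologicalSpace M] [ChartedSpace E M]
    [TopologicalSpace M'] [ChartedSpace E' M'] (f : M → M') (x : M) : Prop :=
  ∃ U : Set M, IsOpen U ∧ x ∈ U ∧ MSmoothOn 𝕜 E E' f U

theorem MSmoothOn.mSmoothAt {f : M → M'} {s : Set M} (hf : MSmoothOn 𝕜 E E' f s) (hs : IsOpen s)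
    {x : M} (hx : x ∈ s) : MSmoothAt 𝕜 E E' f x := ⟨s, hs, hx, hf⟩

theorem MSmooth.mSmoothAt {f : M → M'} (hf : MSmooth 𝕜 E E' f) (x : M) :
    MSmoothAt 𝕜 E E' f x := ⟨univ, isOpen_univ, mem_univ _, hf⟩

theorem mSmoothOn_of_mSmoothAt {f : M → M'} {s : Set M} (h : ∀ x ∈ s, MSmoothAt 𝕜 E E' f x) :
    MSmoothOn 𝕜 E E' f s := MSmoothOn.of_local h

theorem mSmooth_of_mSmoothAt {f : M → M'} (h : ∀ x, MSmoothAt 𝕜 E E' f x) :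
    MSmooth 𝕜 E E' f := MSmoothOn.of_local fun x _ => h x

theorem MSmoothAt.congr {f g : M → M'} {x : M} (hf : MSmoothAt 𝕜 E E' f x) (h : f =ᶠ[𝓝 x] g) :
    MSmoothAt 𝕜 E E' g x := by
  obtain ⟨U, hU, hx, hf⟩ := hf
  obtain ⟨V, hVs, hV, hxV⟩ := mem_nhds_iff.1 h
  exact ⟨U ∩ V, hU.inter hV, ⟨hx, hxV⟩, (hf.mono inter_subset_left).congr (hU.inter hV)
    fun y hy => hVs hy.2⟩

theorem MSmoothAt.comp {g : M' → M''} {f : M → M'} {x : M} (hg : MSmoothAt 𝕜 E' E'' g (f x))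
    (hf : MSmoothAt 𝕜 E E' f x) : MSmoothAt 𝕜 E E'' (fun y => g (f y)) x := by
  obtain ⟨V, hV, hxV, hg⟩ := hg
  obtain ⟨U, hU, hxU, hf⟩ := hf
  have ho := hf.1.isOpen_inter_preimage hU hV
  exact ⟨U ∩ f ⁻¹' V, ho, ⟨hxU, hxV⟩, hg.comp (hf.mono inter_subset_left) hV ho fun y hy => hy.2⟩

theorem MSmooth.comp_mSmoothAt {g : M' → M''} {f : M → M'} {x : M} (hg : MSmooth 𝕜 E' E'' g)
    (hf : MSmoothAt 𝕜 E E' f x) : MSmoothAt 𝕜 E E'' (fun y => g (f y)) x :=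
  (hg.mSmoothAt (f x)).comp hf

theorem MSmoothAt.prodMk {f : M → M'} {g : M → M''} {x : M} (hf : MSmoothAt 𝕜 E E' f x)
    (hg : MSmoothAt 𝕜 E E'' g x) : MSmoothAt 𝕜 E (E' × E'') (fun y => (f y, g y)) x := by
  obtain ⟨U, hU, hxU, hf⟩ := hf
  obtain ⟨V, hV, hxV, hg⟩ := hg
  exact ⟨U ∩ V, hU.inter hV, ⟨hxU, hxV⟩,
    (hf.mono inter_subset_left).prodMk (hg.mono inter_subset_right)⟩

theorem mSmoothAt_id [SmoothManifold 𝕜 E M] (x : M) : MSmoothAt 𝕜 E E (fun y : M => y) x :=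
  (mSmoothOn_id univ).mSmoothAt isOpen_univ (mem_univ _)

theorem mSmoothAt_const (c : M') (x : M) : MSmoothAt 𝕜 E E' (fun _ : M => c) x :=
  (mSmoothOn_const c univ).mSmoothAt isOpen_univ (mem_univ _)

theorem mSmoothAt_fst [SmoothManifold 𝕜 E M] (x : M × M') :
    MSmoothAt 𝕜 (E × E') E (fun p : M × M' => p.1) x :=
  (mSmoothOn_fst univ).mSmoothAt isOpen_univ (mem_univ _)

theorem mSmoothAt_snd [SmoothManifold 𝕜 E' M'] (x : M × M') :
    MSmoothAt 𝕜 (E × E') E' (fun p : M × M' => p.2) x :=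
  (mSmoothOn_snd univ).mSmoothAt isOpen_univ (mem_univ _)

end Manifolds

/-! ### Lie groups from local data at the identity. -/

section LieGroups

variable {𝕜 E E' : Type*} [RCLike 𝕜]
  [AddCommGroup E] [Module 𝕜 E] [TopologicalSpace E] [LocallyConvexTVS 𝕜 E]
  [AddCommGroup E'] [Module 𝕜 E'] [TopologicalSpace E'] [LocallyConvexTVS 𝕜 E']
  {X X' M : Type*} [Group X] [TopologicalSpace X] [ChartedSpace E X]
  [Group X'] [TopologicalSpace X'] [ChartedSpace E' X']

variable (𝕜 E X) in
theorem LieGrp.isTopologicalGroup [LieGrp 𝕜 E X] : IsTopologicalGroup X where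
  continuous_mul := continuousOn_univ.1 (LieGrp.smooth_mul (𝕜 := 𝕜) (E := E) (G := X)).1
  continuous_inv := continuousOn_univ.1 (LieGrp.smooth_inv (𝕜 := 𝕜) (E := E) (G := X)).1

section

variable {E₁ : Type*} [AddCommGroup E₁] [Module 𝕜 E₁] [TopologicalSpace E₁]
  [LocallyConvexTVS 𝕜 E₁] [TopologicalSpace M] [ChartedSpace E₁ M] [LieGrp 𝕜 E X]

theorem MSmoothAt.mul {f g : M → X} {x : M} (hf : MSmoothAt 𝕜 E₁ E f x)
    (hg : MSmoothAt 𝕜 E₁ E g x) : MSmoothAt 𝕜 E₁ E (fun y => f y * g y) x :=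
  (LieGrp.smooth_mul (𝕜 := 𝕜) (E := E) (G := X)).comp_mSmoothAt (hf.prodMk hg)

theorem MSmoothAt.inv {f : M → X} {x : M} (hf : MSmoothAt 𝕜 E₁ E f x) :
    MSmoothAt 𝕜 E₁ E (fun y => (f y)⁻¹) x :=
  (LieGrp.smooth_inv (𝕜 := 𝕜) (E := E) (G := X)).comp_mSmoothAt hf

end

theorem mSmooth_of_hom [LieGrp 𝕜 E X] [LieGrp 𝕜 E' X'] (φ : X →* X')
    (h : MSmoothAt 𝕜 E E' φ 1) : MSmooth 𝕜 E E' φ := by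
  refine mSmooth_of_mSmoothAt fun a => ?_
  have h1 : MSmoothAt 𝕜 E E (fun x => a⁻¹ * x) a := (mSmoothAt_const _ _).mul (mSmoothAt_id _)
  have h2 : MSmoothAt 𝕜 E E' (fun x => φ a * φ (a⁻¹ * x)) a :=
    (mSmoothAt_const _ _).mul (MSmoothAt.comp (by simpa using h) h1)
  simpa using h2

/-- Right translations are not assumed smooth; conjugation near `1` replaces them. Near `(a, b)` one
has `x * y = a * b * ((b⁻¹ * (a⁻¹ * x) * b) * (b⁻¹ * y))`, and near `a` one has `x⁻¹ = a⁻¹ * (a *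
(a⁻¹ * x)⁻¹ * a⁻¹)`. -/
theorem LieGrp.of_local [SmoothManifold 𝕜 E X]
    (hl : ∀ a : X, MSmooth 𝕜 E E (fun x => a * x))
    (hm : MSmoothAt 𝕜 (E × E) E (fun p : X × X => p.1 * p.2) 1)
    (hi : MSmoothAt 𝕜 E E (fun x : X => x⁻¹) 1)
    (hc : ∀ a : X, MSmoothAt 𝕜 E E (fun x : X => a * x * a⁻¹) 1) : LieGrp 𝕜 E X where
  smooth_mul := by
    refine mSmooth_of_mSmoothAt fun ⟨a, b⟩ => ?_
    have h1 : MSmoothAt 𝕜 (E × E) E (fun p : X × X => b⁻¹ * (a⁻¹ * p.1) * b⁻¹⁻¹) (a, b) := by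
      refine MSmoothAt.comp (E' := E) (f := fun p : X × X => a⁻¹ * p.1)
        (g := fun x => b⁻¹ * x * b⁻¹⁻¹) ?_ ?_
      · simpa using hc b⁻¹
      · exact (hl _).comp_mSmoothAt (mSmoothAt_fst _)
    have h2 : MSmoothAt 𝕜 (E × E) E (fun p : X × X => b⁻¹ * p.2) (a, b) :=
      (hl _).comp_mSmoothAt (mSmoothAt_snd _)
    have h3 := MSmoothAt.comp (g := fun p : X × X => p.1 * p.2)
      (by simpa [Prod.one_eq_mk] using hm) (h1.prodMk h2)
    have h4 := (hl (a * b)).comp_mSmoothAt h3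
    simpa [mul_assoc] using h4
  smooth_inv := by
    refine mSmooth_of_mSmoothAt fun a => ?_
    have h1 : MSmoothAt 𝕜 E E (fun x => a⁻¹ * x) a := (hl _).mSmoothAt a
    have h2 : MSmoothAt 𝕜 E E (fun x => (a⁻¹ * x)⁻¹) a := MSmoothAt.comp (by simpa using hi) h1
    have h3 : MSmoothAt 𝕜 E E (fun x => a * (a⁻¹ * x)⁻¹ * a⁻¹) a :=
      MSmoothAt.comp (g := fun x => a * x * a⁻¹) (by simpa using hc a) h2
    have h4 := (hl a⁻¹).comp_mSmoothAt h3
    simpa [mul_assoc] using h4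

end LieGroups

/-! ### Manifold structures from charts with values in a manifold. -/

section CompositeCharts

variable {𝕜 E M X : Type*} [RCLike 𝕜]
  [AddCommGroup E] [Module 𝕜 E] [TopologicalSpace E] [LocallyConvexTVS 𝕜 E]
  [TopologicalSpace M] [ChartedSpace E M]
  [TopologicalSpace X] [ChartedSpace M X]

/-- A change of composite charts is the expression of `Ψ ∘ Φ.symm` in charts of `M`. -/
theorem SmoothManifold.comp
    (h : ∀ Φ ∈ atlas M X, ∀ Ψ ∈ atlas M X,
      MSmoothOn 𝕜 E E (Ψ ∘ Φ.symm) (Φ.target ∩ Φ.symm ⁻¹' Ψ.source)) :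
    @SmoothManifold 𝕜 E X _ _ _ _ _ _ (ChartedSpace.comp E M X) := by
  let := ChartedSpace.comp E M X
  refine ⟨?_⟩
  rintro _ ⟨Φ, hΦ, e, he, rfl⟩ _ ⟨Ψ, hΨ, e', he', rfl⟩
  refine ((h Φ hΦ Ψ hΨ).2 e he e' he').mono fun y hy => ?_
  exact ⟨hy.1.1, ⟨hy.1.2, hy.2.1⟩, hy.2.2⟩

theorem mSmoothOn_chart_of_comp
    (h : ∀ Φ ∈ atlas M X, ∀ Ψ ∈ atlas M X,
      MSmoothOn 𝕜 E E (Ψ ∘ Φ.symm) (Φ.target ∩ Φ.symm ⁻¹' Ψ.source))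
    {Φ : OpenPartialHomeomorph X M} (hΦ : Φ ∈ atlas M X) :
    @MSmoothOn 𝕜 E E _ _ _ _ _ _ _ X M _ (ChartedSpace.comp E M X) _ _ Φ Φ.source := by
  let := ChartedSpace.comp E M X
  refine ⟨Φ.continuousOn, ?_⟩
  rintro _ ⟨Ψ, hΨ, e, he, rfl⟩ e' he'
  refine ((h Ψ hΨ Φ hΦ).2 e he e' he').mono fun y hy => ?_
  exact ⟨hy.1.1, ⟨hy.1.2, hy.2.1⟩, hy.2.2⟩

theorem mSmoothOn_chart_symm_of_comp
    (h : ∀ Φ ∈ atlas M X, ∀ Ψ ∈ atlas M X,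
      MSmoothOn 𝕜 E E (Ψ ∘ Φ.symm) (Φ.target ∩ Φ.symm ⁻¹' Ψ.source))
    {Φ : OpenPartialHomeomorph X M} (hΦ : Φ ∈ atlas M X) :
    @MSmoothOn 𝕜 E E _ _ _ _ _ _ _ M X _ _ _ (ChartedSpace.comp E M X) Φ.symm Φ.target := by
  let := ChartedSpace.comp E M X
  refine ⟨Φ.symm.continuousOn, ?_⟩
  rintro e he _ ⟨Ψ, hΨ, e', he', rfl⟩
  refine ((h Φ hΦ Ψ hΨ).2 e he e' he').mono fun y hy => ?_
  exact ⟨hy.1, ⟨hy.2.1, hy.2.2.1⟩, hy.2.2.2⟩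

end CompositeCharts

theorem exists_inl_eq_of_rightHom_eq_one {N H G : Type*} [Group N] [Group H] [Group G]
    (ext : GroupExtension N H G) {x : H}
    (hx : ext.rightHom x = 1) : ∃ n, ext.inl n = x := by
  rwa [← MonoidHom.mem_range, ext.range_inl_eq_ker_rightHom, MonoidHom.mem_ker]

/-! ### Extensions: initiality of the kernel and local sections. -/

section Extensions

variable {𝕜 EN EH EG E₁ : Type*} [RCLike 𝕜]
  [AddCommGroup EN] [Module 𝕜 EN] [TopologicalSpace EN] [LocallyConvexTVS 𝕜 EN]
  [AddCommGroup EH] [Module 𝕜 EH] [TopologicalSpace EH] [LocallyConvexTVS 𝕜 EH]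
  [AddCommGroup EG] [Module 𝕜 EG] [TopologicalSpace EG] [LocallyConvexTVS 𝕜 EG]
  [AddCommGroup E₁] [Module 𝕜 E₁] [TopologicalSpace E₁] [LocallyConvexTVS 𝕜 E₁]
  {N H G M : Type*} [Group N] [TopologicalSpace N] [ChartedSpace EN N] [LieGrp 𝕜 EN N]
  [Group H] [TopologicalSpace H] [ChartedSpace EH H] [LieGrp 𝕜 EH H]
  [Group G] [TopologicalSpace G] [ChartedSpace EG G] [LieGrp 𝕜 EG G]
  [TopologicalSpace M] [ChartedSpace E₁ M]
  {ext : GroupExtension N H G}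

/-- The kernel inclusion of a Lie group extension is initial for smooth maps. -/
theorem IsLieExtension.mSmoothAt_of_inl (hext : IsLieExtension 𝕜 EN EH EG ext) {f : M → N} {x : M}
    (hf : MSmoothAt 𝕜 E₁ EH (fun y => ext.inl (f y)) x) : MSmoothAt 𝕜 E₁ EN f x := by
  obtain ⟨U, hU, h1U, s, -, -, himg, -, r, hr, hrs⟩ := hext.locally_trivial 1
  have h1 : MSmoothAt 𝕜 E₁ EH (fun y => s 1 * ext.inl (f y)) x := (mSmoothAt_const _ _).mul hf
  have hmem : ∀ n : N, ((1, n) : G × N) ∈ U ×ˢ (univ : Set N) := fun n => ⟨h1U, mem_univ _⟩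
  -- Over the point `1` of `U`, the inverse trivialization `r` reads `n` off `s 1 * ι n`.
  have h2 : MSmoothAt 𝕜 E₁ EN (fun y => (r (s 1 * ext.inl (f y))).2) x :=
    (mSmoothAt_snd _).comp
      (MSmoothAt.comp (hrs.mSmoothAt himg (mem_image_of_mem _ (hmem (f x)))) h1)
  have h3 : (fun y => (r (s 1 * ext.inl (f y))).2) = f := funext fun y =>
    congrArg Prod.snd (hr (hmem (f y)))
  rwa [h3] at h2

/-- A Lie group extension has a section that is smooth near the identity. -/
theorem IsLieExtension.exists_section (hext : IsLieExtension 𝕜 EN EH EG ext) :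
    ∃ σ : ext.Section, IsC1s 𝕜 EG EH σ := by
  classical
  obtain ⟨U, hU, h1U, s, hs, hopen, -, hp, -⟩ := hext.locally_trivial 1
  -- Dividing by `s 1`, which lies in the kernel, normalizes the section; off `U` any preimage will
  -- do.
  let σ : G → H := fun x =>
    if x ∈ U then s x * (s 1)⁻¹ else Function.surjInv ext.rightHom_surjective x
  have hσ : Function.RightInverse σ ext.rightHom := by
    intro x
    by_cases hx : x ∈ U
    · simp [σ, hx, hs x hx, hs 1 h1U]
    · simp [σ, hx, Function.surjInv_eq]
  refine ⟨⟨σ, hσ⟩, ?_, U, hU, h1U, mSmoothOn_of_mSmoothAt fun x hx => ?_⟩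
  · simp [σ, h1U]
  · have h1 : MSmoothAt 𝕜 EG EH (fun y => s y * ext.inl 1) x :=
      MSmoothAt.comp (f := fun y : G => (y, (1 : N))) (hp.mSmoothAt hopen ⟨hx, mem_univ _⟩)
        ((mSmoothAt_id x).prodMk (mSmoothAt_const _ _))
    refine (h1.mul (mSmoothAt_const (s 1)⁻¹ x)).congr ?_
    filter_upwards [hU.mem_nhds hx] with y hy
    simp [σ, hy]

/-- One local section at `1` suffices: `x ↦ a * s (q(a)⁻¹ * x)` is a section near `q(a)`. The
inverse of its trivialization is `y ↦ (q y, ι⁻¹ (s'(q y)⁻¹ * y))`, whose second component is smooth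
by the assumed initiality `hinit`. -/
theorem IsLieExtension.of_local_section (hi : MSmooth 𝕜 EN EH ext.inl)
    (hq : MSmooth 𝕜 EH EG ext.rightHom)
    (hinit : ∀ (f : H → N) (x : H), MSmoothAt 𝕜 EH EH (fun y => ext.inl (f y)) x →
      MSmoothAt 𝕜 EH EN f x)
    {U : Set G} (hU : IsOpen U) (h1U : 1 ∈ U) {s : G → H} (hs : ∀ x ∈ U, ext.rightHom (s x) = x)
    (hss : MSmoothOn 𝕜 EG EH s U) : IsLieExtension 𝕜 EN EH EG ext := by
  refine ⟨hi, hq, fun g => ?_⟩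
  obtain ⟨a, rfl⟩ := ext.rightHom_surjective g
  have : IsTopologicalGroup G := LieGrp.isTopologicalGroup 𝕜 EG G
  set U' : Set G := {x | (ext.rightHom a)⁻¹ * x ∈ U} with hU'
  have hoU' : IsOpen U' := hU.preimage (continuous_const_mul _)
  let s' : G → H := fun x => a * s ((ext.rightHom a)⁻¹ * x)
  have hs' : ∀ x ∈ U', ext.rightHom (s' x) = x := fun x hx => by
    simp [s', hs _ hx]
  have hss' : ∀ x ∈ U', MSmoothAt 𝕜 EG EH s' x := fun x hx =>
    (mSmoothAt_const a x).mul (MSmoothAt.comp (hss.mSmoothAt hU hx)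
      ((mSmoothAt_const _ x).mul (mSmoothAt_id x)))
  have hqc : Continuous ext.rightHom := continuousOn_univ.1 hq.1
  have himg : (fun p : G × N => s' p.1 * ext.inl p.2) '' (U' ×ˢ univ) = ext.rightHom ⁻¹' U' := by
    ext y
    constructor
    · rintro ⟨⟨x, n⟩, ⟨hx, -⟩, rfl⟩
      simpa [hs' x hx] using hx
    · intro hy
      obtain ⟨n, hn⟩ := exists_inl_eq_of_rightHom_eq_one ext
        (x := (s' (ext.rightHom y))⁻¹ * y) (by simp [hs' _ hy])
      exact ⟨(ext.rightHom y, n), ⟨hy, mem_univ _⟩, by simp [hn]⟩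
  refine ⟨U', hoU', by simpa [hU'] using h1U, s', hs', hoU'.prod isOpen_univ, ?_, ?_,
    fun y => (ext.rightHom y, Function.invFun ext.inl ((s' (ext.rightHom y))⁻¹ * y)), ?_, ?_⟩
  · rw [himg]
    exact hoU'.preimage hqc
  · refine mSmoothOn_of_mSmoothAt fun p hp => ?_
    exact ((hss' _ hp.1).comp (mSmoothAt_fst p)).mul (hi.comp_mSmoothAt (mSmoothAt_snd p))
  · rintro ⟨x, n⟩ ⟨hx, -⟩
    simp [hs' x hx, Function.leftInverse_invFun ext.inl_injective n]
  · rw [himg]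
    refine mSmoothOn_of_mSmoothAt fun y hy => ?_
    refine (hq.mSmoothAt y).prodMk (hinit _ _ ?_)
    have h1 : MSmoothAt 𝕜 EH EH (fun y => (s' (ext.rightHom y))⁻¹ * y) y :=
      ((hss' _ hy).comp (hq.mSmoothAt y)).inv.mul (mSmoothAt_id y)
    refine h1.congr ?_
    filter_upwards [(hoU'.preimage hqc).mem_nhds hy] with z hz
    exact (Function.invFun_eq (exists_inl_eq_of_rightHom_eq_one ext
      (by simp [hs' _ hz]))).symm

end Extensions

/-! ### The factor system of a section, algebraically. -/

section SectionCocycle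

variable {N H G : Type*} [Group N] [Group H] [Group G] {ext : GroupExtension N H G}

theorem inl_sectionAct (σ : ext.Section) (g : G) (n : N) :
    ext.inl (sectionAct σ g n) = σ g * ext.inl n * (σ g)⁻¹ := ext.inl_conjAct_comm

theorem inl_sectionAct_symm (σ : ext.Section) (g : G) (n : N) :
    ext.inl ((sectionAct σ g).symm n) = (σ g)⁻¹ * ext.inl n * σ g := by
  have := inl_sectionAct σ g ((sectionAct σ g).symm n)
  rw [MulEquiv.apply_symm_apply] at this
  simp [this, mul_assoc]

theorem isFactorSystem_section (σ : ext.Section) (h1 : σ 1 = 1) :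
    IsFactorSystem (sectionAct σ) (sectionCocycle σ) where
  map_one := by simp [sectionAct, h1]
  right_one g := ext.inl_injective (by simp [inl_sectionCocycle, h1])
  left_one g := ext.inl_injective (by simp [inl_sectionCocycle, h1])
  delta_eq g g' := by
    rw [mul_inv_eq_iff_eq_mul]
    ext n
    apply ext.inl_injective
    simp [inl_sectionAct, inl_sectionCocycle, mul_assoc]
  cocycle g g' g'' := by
    apply ext.inl_injective
    simp [inl_sectionAct, inl_sectionCocycle, mul_assoc]

/-- The equivalence of an extension with the twisted product of the factor system of a section. -/
noncomputable def sectionEquiv (σ : ext.Section) (h : IsFactorSystem (sectionAct σ)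
    (sectionCocycle σ)) : (TwistedProduct.extension h).Equiv ext where
  toMulEquiv := MulEquiv.ofBijective
    (MonoidHom.mk' (fun a : TwistedProduct h => ext.inl a.fst * σ a.snd) (by
      intro a b
      simp [TwistedProduct.mul_def, inl_sectionAct, inl_sectionCocycle, mul_assoc])) (by
      constructor
      · intro a b hab
        have hab : ext.inl a.fst * σ a.snd = ext.inl b.fst * σ b.snd := hab
        have h2 : a.snd = b.snd := by simpa using congrArg ext.rightHom hab
        rw [h2, mul_left_inj] at hab
        exact TwistedProduct.ext (ext.inl_injective hab) h2
      · intro y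
        obtain ⟨n, hn⟩ := exists_inl_eq_of_rightHom_eq_one ext
          (x := y * (σ (ext.rightHom y))⁻¹) (by simp)
        exact ⟨⟨n, ext.rightHom y⟩, by simp [hn]⟩)
  inl_comm := by
    -- Normalization of the cocycle already forces this, as `σ 1 * σ 1 * (σ 1)⁻¹ = σ 1`.
    have h1 : σ 1 = 1 := by
      have := inl_sectionCocycle σ 1 1
      simpa [h.left_one] using this.symm
    ext n
    change ext.inl n * σ 1 = ext.inl n
    rw [h1, mul_one]
  rightHom_comm := by
    ext a
    change ext.rightHom (ext.inl a.fst * σ a.snd) = a.snd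
    simp

theorem sectionEquiv_apply (σ : ext.Section) (h : IsFactorSystem (sectionAct σ)
    (sectionCocycle σ)) (a : TwistedProduct h) :
    sectionEquiv σ h a = ext.inl a.fst * σ a.snd := rfl

theorem inl_sectionEquiv_symm_fst (σ : ext.Section) (h : IsFactorSystem (sectionAct σ)
    (sectionCocycle σ)) (y : H) :
    ext.inl ((sectionEquiv σ h).symm y).fst = y * (σ (ext.rightHom y))⁻¹ := by
  have h1 : sectionEquiv σ h ((sectionEquiv σ h).symm y) = y :=
    (sectionEquiv σ h).toMulEquiv.apply_symm_apply y
  have h2 : ((sectionEquiv σ h).symm y).snd = ext.rightHom y := by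
    conv_rhs => rw [← h1]
    simp [sectionEquiv_apply]
  rw [sectionEquiv_apply, h2] at h1
  rw [eq_mul_inv_iff_mul_eq, h1]

theorem sectionEquiv_symm_snd (σ : ext.Section) (h : IsFactorSystem (sectionAct σ)
    (sectionCocycle σ)) (y : H) : ((sectionEquiv σ h).symm y).snd = ext.rightHom y :=
  (sectionEquiv σ h).symm.rightHom_map y

end SectionCocycle

/-! ### Smoothness of the factor system of a section. -/

section SmoothSectionCocycle

variable {𝕜 EN EH EG : Type*} [RCLike 𝕜]
  [AddCommGroup EN] [Module 𝕜 EN] [TopologicalSpace EN] [LocallyConvexTVS 𝕜 EN]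
  [AddCommGroup EH] [Module 𝕜 EH] [TopologicalSpace EH] [LocallyConvexTVS 𝕜 EH]
  [AddCommGroup EG] [Module 𝕜 EG] [TopologicalSpace EG] [LocallyConvexTVS 𝕜 EG]
  {N H G : Type*} [Group N] [TopologicalSpace N] [ChartedSpace EN N] [LieGrp 𝕜 EN N]
  [Group H] [TopologicalSpace H] [ChartedSpace EH H] [LieGrp 𝕜 EH H]
  [Group G] [TopologicalSpace G] [ChartedSpace EG G] [LieGrp 𝕜 EG G]
  {ext : GroupExtension N H G}

theorem IsLieExtension.isSmoothFactorSystem (hext : IsLieExtension 𝕜 EN EH EG ext)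
    {σ : ext.Section} (hσ : IsC1s 𝕜 EG EH σ) :
    IsSmoothFactorSystem 𝕜 EG EN (sectionAct σ) (sectionCocycle σ) := by
  have hfs := isFactorSystem_section σ hσ.1
  obtain ⟨h1, U, hU, h1U, hσU⟩ := hσ
  have : IsTopologicalGroup G := LieGrp.isTopologicalGroup 𝕜 EG G
  have hσ' : ∀ x ∈ U, MSmoothAt 𝕜 EG EH σ x := fun x hx => hσU.mSmoothAt hU hx
  have hinl := hext.smooth_inl
  refine ⟨hfs, ⟨fun g => ⟨?_, ?_⟩, hfs.map_one, U, hU, h1U, ?_⟩,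
    ⟨hfs.right_one, hfs.left_one, ?_⟩, fun g => ?_⟩
  · refine mSmooth_of_mSmoothAt fun n => hext.mSmoothAt_of_inl ?_
    simp only [inl_sectionAct]
    exact ((mSmoothAt_const _ _).mul (hinl.mSmoothAt n)).mul (mSmoothAt_const _ _)
  · refine mSmooth_of_mSmoothAt fun n => hext.mSmoothAt_of_inl ?_
    simp only [inl_sectionAct_symm]
    exact ((mSmoothAt_const _ _).mul (hinl.mSmoothAt n)).mul (mSmoothAt_const _ _)
  · refine mSmoothOn_of_mSmoothAt fun p hp => hext.mSmoothAt_of_inl ?_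
    simp only [inl_sectionAct]
    have h2 : MSmoothAt 𝕜 (EG × EN) EH (fun p : G × N => σ p.1) p :=
      (hσ' _ hp.1).comp (mSmoothAt_fst p)
    exact (h2.mul (hinl.comp_mSmoothAt (mSmoothAt_snd p))).mul h2.inv
  · refine ⟨(U ×ˢ U) ∩ {p | p.1 * p.2 ∈ U}, (hU.prod hU).inter (hU.preimage continuous_mul),
      ⟨⟨h1U, h1U⟩, by simpa using h1U⟩, ?_⟩
    refine mSmoothOn_of_mSmoothAt fun p hp => hext.mSmoothAt_of_inl ?_
    simp only [inl_sectionCocycle]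
    exact (((hσ' _ hp.1.1).comp (mSmoothAt_fst p)).mul
      ((hσ' _ hp.1.2).comp (mSmoothAt_snd p))).mul
      (MSmoothAt.comp (f := fun p : G × G => p.1 * p.2) (hσ' _ hp.2)
        ((mSmoothAt_fst p).mul (mSmoothAt_snd p))).inv
  · refine ⟨U ∩ {x | g * x * g⁻¹ ∈ U}, hU.inter (hU.preimage (by fun_prop)),
      ⟨h1U, by simpa using h1U⟩, ?_⟩
    refine mSmoothOn_of_mSmoothAt fun x hx => hext.mSmoothAt_of_inl ?_
    -- The two factors `σ (g * x)` cancel because `g * x * g⁻¹ * g = g * x`. What remains evaluates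
    -- `σ` near `1`, apart from the constant `σ g`.
    have h2 : (fun x => ext.inl (sectionCocycle σ g x * (sectionCocycle σ (g * x * g⁻¹) g)⁻¹)) =
        fun x => σ g * σ x * (σ g)⁻¹ * (σ (g * x * g⁻¹))⁻¹ := by
      ext x
      simp [inl_sectionCocycle, mul_assoc]
    rw [h2]
    exact ((((mSmoothAt_const _ _).mul (hσ' x hx.1)).mul (mSmoothAt_const _ _))).mul
      (MSmoothAt.comp (f := fun x => g * x * g⁻¹) (hσ' _ hx.2)
        (((mSmoothAt_const _ _).mul (mSmoothAt_id x)).mul (mSmoothAt_const _ _))).inv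

end SmoothSectionCocycle

namespace TwistedProduct

/-! ### Algebra of the twisted product and its translated charts. -/

section Algebra

variable {N G : Type*} [Group N] [Group G] {S : G → MulAut N} {ω : G → G → N}

/-- The identity map `N ×_(S,ω) G → N × G`. -/
def toProd {h : IsFactorSystem S ω} (a : TwistedProduct h) : N × G := (a.fst, a.snd)

variable (h : IsFactorSystem S ω)

@[simp] theorem toProd_ofProd (p : N × G) : toProd (ofProd h p) = p := rfl

@[simp] theorem ofProd_toProd (a : TwistedProduct h) : ofProd h (toProd a) = a := rfl

theorem ofProd_mul (p r : N × G) :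
    ofProd h p * ofProd h r = ofProd h (p.1 * S p.2 r.1 * ω p.2 r.2, p.2 * r.2) := rfl

theorem ofProd_inv (p : N × G) :
    (ofProd h p)⁻¹ = ofProd h ((ω p.2⁻¹ p.2)⁻¹ * S p.2⁻¹ p.1⁻¹, p.2⁻¹) := rfl

/-- Split `(m, c) = (m, 1) * (1, c)` and move `(1, c)` past `(n, g)`. The values of `ω` at the
possibly distant `c` then occur only in the combination that `IsC2ss` makes smooth. -/
theorem ofProd_conj (m n : N) (c g : G) :
    ofProd h (m, c) * ofProd h (n, g) * (ofProd h (m, c))⁻¹ =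
      ofProd h (m, 1) * ofProd h (S c n * (ω c g * (ω (c * g * c⁻¹) c)⁻¹), c * g * c⁻¹) *
        ofProd h (m⁻¹, 1) := by
  have h1 : ofProd h (m, c) = ofProd h (m, 1) * ofProd h (1, c) := by
    simp [ofProd_mul, h.left_one, h.map_one]
  have h2 : (ofProd h (m, 1))⁻¹ = ofProd h (m⁻¹, 1) := by
    simp [ofProd_inv, h.left_one, h.map_one]
  have h3 : ofProd h (1, c) * ofProd h (n, g) =
      ofProd h (S c n * (ω c g * (ω (c * g * c⁻¹) c)⁻¹), c * g * c⁻¹) * ofProd h (1, c) := by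
    simp [ofProd_mul, mul_assoc]
  rw [h1, mul_inv_rev, h2, mul_assoc (ofProd h (m, 1)), h3]
  group

@[simp] theorem one_snd : (1 : TwistedProduct h).snd = 1 := rfl

@[simp] theorem inv_snd (a : TwistedProduct h) : a⁻¹.snd = a.snd⁻¹ := rfl

@[simp] theorem ofProd_snd (p : N × G) : (ofProd h p).snd = p.2 := rfl

@[simp] theorem toProd_snd (a : TwistedProduct h) : (toProd a).2 = a.snd := rfl

@[simp] theorem mul_snd (a b : TwistedProduct h) : (a * b).snd = a.snd * b.snd := rfl

theorem image_ofProd (U : Set G) :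
    ofProd h '' (univ ×ˢ U) = {x | x.snd ∈ U} := by
  ext x
  constructor
  · rintro ⟨p, ⟨-, hp⟩, rfl⟩
    exact hp
  · intro hx
    exact ⟨toProd x, ⟨mem_univ _, hx⟩, rfl⟩

/-- The chart of `N ×_(S,ω) G` with values in `N × W` that is obtained from the identity map by a
left translation. -/
def leftChart (W : Set G) (a : TwistedProduct h) : PartialEquiv (TwistedProduct h) (N × G) where
  toFun x := toProd (a⁻¹ * x)
  invFun p := a * ofProd h p
  source := {x | a.snd⁻¹ * x.snd ∈ W}
  target := univ ×ˢ W
  map_source' _ hx := ⟨mem_univ _, hx⟩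
  map_target' p hp := by simpa [ofProd] using hp.2
  left_inv' x _ := by simp
  right_inv' p _ := by simp

theorem leftChart_apply (W : Set G) (a x : TwistedProduct h) :
    leftChart h W a x = toProd (a⁻¹ * x) := rfl

theorem leftChart_symm_apply (W : Set G) (a : TwistedProduct h) (p : N × G) :
    (leftChart h W a).symm p = a * ofProd h p := rfl

theorem leftChart_symm_trans_source (W : Set G) (a b : TwistedProduct h) :
    ((leftChart h W a).symm.trans (leftChart h W b)).source =
      {p : N × G | p.2 ∈ W ∧ b.snd⁻¹ * (a.snd * p.2) ∈ W} := by
  rw [PartialEquiv.trans_source]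
  ext p
  simp only [mem_inter_iff, mem_preimage, leftChart_symm_apply, PartialEquiv.symm_source]
  simp [leftChart]

end Algebra

/-! ### Construction of the Lie group structure. -/

section Smooth

variable {𝕜 EN EG : Type*} [RCLike 𝕜]
  [AddCommGroup EN] [Module 𝕜 EN] [TopologicalSpace EN] [LocallyConvexTVS 𝕜 EN]
  [AddCommGroup EG] [Module 𝕜 EG] [TopologicalSpace EG] [LocallyConvexTVS 𝕜 EG]
  {N G : Type*} [Group N] [TopologicalSpace N] [ChartedSpace EN N] [LieGrp 𝕜 EN N]
  [Group G] [TopologicalSpace G] [ChartedSpace EG G] [LieGrp 𝕜 EG G]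
  {S : G → MulAut N} {ω : G → G → N}

theorem exists_smooth_nhds_one (hs : IsSmoothFactorSystem 𝕜 EG EN S ω) :
    ∃ U : Set G, IsOpen U ∧ 1 ∈ U ∧
      (∀ p : G × N, p.1 ∈ U → MSmoothAt 𝕜 (EG × EN) EN (fun p : G × N => S p.1 p.2) p) ∧
      ∀ p : G × G, p.1 ∈ U → p.2 ∈ U →
        MSmoothAt 𝕜 (EG × EG) EN (fun p : G × G => ω p.1 p.2) p := by
  obtain ⟨-, -, U, hU, h1U, hSU⟩ := hs.isC1sAut
  obtain ⟨⟨-, -, V, hV, h1V, hωV⟩, -⟩ := hs.isC2ss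
  obtain ⟨A, B, hA, h1A, hB, h1B, hAB⟩ := mem_nhds_prod_iff'.1 (hV.mem_nhds h1V)
  exact ⟨U ∩ (A ∩ B), hU.inter (hA.inter hB), ⟨h1U, h1A, h1B⟩,
    fun p hp => hSU.mSmoothAt (hU.prod isOpen_univ) ⟨hp.1, mem_univ _⟩,
    fun p hp hp' => hωV.mSmoothAt hV (hAB ⟨hp.2.1, hp'.2.2⟩)⟩

section

variable {E₁ M : Type*} [AddCommGroup E₁] [Module 𝕜 E₁] [TopologicalSpace E₁]
  [LocallyConvexTVS 𝕜 E₁] [TopologicalSpace M] [ChartedSpace E₁ M]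
  (h : IsFactorSystem S ω) {U : Set G}

/-- Phrased with maps into `N × G`, so that it needs no manifold structure on the twisted product:
it gives the chart changes first and multiplication near `1` afterwards. -/
theorem mSmoothAt_toProd_mul
    (hS : ∀ p : G × N, p.1 ∈ U → MSmoothAt 𝕜 (EG × EN) EN (fun p : G × N => S p.1 p.2) p)
    (hω : ∀ p : G × G, p.1 ∈ U → p.2 ∈ U →
        MSmoothAt 𝕜 (EG × EG) EN (fun p : G × G => ω p.1 p.2) p)
    {f f' : M → N × G} {x : M} (hf : MSmoothAt 𝕜 E₁ (EN × EG) f x)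
    (hf' : MSmoothAt 𝕜 E₁ (EN × EG) f' x) (hx : (f x).2 ∈ U) (hx' : (f' x).2 ∈ U) :
    MSmoothAt 𝕜 E₁ (EN × EG) (fun y => toProd (ofProd h (f y) * ofProd h (f' y))) x := by
  have h1 := (mSmoothAt_fst (𝕜 := 𝕜) (f x)).comp hf
  have h2 := (mSmoothAt_snd (𝕜 := 𝕜) (f x)).comp hf
  have h1' := (mSmoothAt_fst (𝕜 := 𝕜) (f' x)).comp hf'
  have h2' := (mSmoothAt_snd (𝕜 := 𝕜) (f' x)).comp hf'
  have h3 := MSmoothAt.comp (f := fun y => ((f y).2, (f' y).1)) (hS _ hx) (h2.prodMk h1')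
  have h4 := MSmoothAt.comp (f := fun y => ((f y).2, (f' y).2)) (hω _ hx hx') (h2.prodMk h2')
  exact ((h1.mul h3).mul h4).prodMk (h2.mul h2')

theorem mSmoothAt_toProd_inv
    (hS : ∀ p : G × N, p.1 ∈ U → MSmoothAt 𝕜 (EG × EN) EN (fun p : G × N => S p.1 p.2) p)
    (hω : ∀ p : G × G, p.1 ∈ U → p.2 ∈ U →
        MSmoothAt 𝕜 (EG × EG) EN (fun p : G × G => ω p.1 p.2) p)
    {f : M → N × G} {x : M} (hf : MSmoothAt 𝕜 E₁ (EN × EG) f x)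
    (hx : (f x).2 ∈ U) (hx' : (f x).2⁻¹ ∈ U) :
    MSmoothAt 𝕜 E₁ (EN × EG) (fun y => toProd (ofProd h (f y))⁻¹) x := by
  have h1 := (mSmoothAt_fst (𝕜 := 𝕜) (f x)).comp hf
  have h2 := (mSmoothAt_snd (𝕜 := 𝕜) (f x)).comp hf
  have h3 := MSmoothAt.comp (f := fun y => ((f y).2⁻¹, (f y).1⁻¹)) (hS _ hx')
    (h2.inv.prodMk h1.inv)
  have h4 := MSmoothAt.comp (f := fun y => ((f y).2⁻¹, (f y).2)) (hω _ hx' hx) (h2.inv.prodMk h2)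
  exact (h4.inv.mul h3).prodMk h2.inv

end

theorem mSmoothAt_toProd_conj {E₁ M : Type*} [AddCommGroup E₁] [Module 𝕜 E₁]
    [TopologicalSpace E₁] [LocallyConvexTVS 𝕜 E₁] [TopologicalSpace M] [ChartedSpace E₁ M]
    (hs : IsSmoothFactorSystem 𝕜 EG EN S ω) (a : TwistedProduct hs.toIsFactorSystem)
    {f : M → N × G} {x : M} (hf : MSmoothAt 𝕜 E₁ (EN × EG) f x) (hx : (f x).2 = 1) :
    MSmoothAt 𝕜 E₁ (EN × EG)
      (fun y => toProd (a * ofProd hs.toIsFactorSystem (f y) * a⁻¹)) x := by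
  obtain ⟨U, hU, h1U, hS, hω⟩ := exists_smooth_nhds_one hs
  have h := hs.toIsFactorSystem
  obtain ⟨m, c⟩ := a
  obtain ⟨V, hV, h1V, hVs⟩ := hs.isC2ss.2 c
  have h1 := (mSmoothAt_fst (𝕜 := 𝕜) (f x)).comp hf
  have h2 := (mSmoothAt_snd (𝕜 := 𝕜) (f x)).comp hf
  have h3 : MSmoothAt 𝕜 E₁ (EN × EG)
      (fun y => (S c (f y).1 * (ω c (f y).2 * (ω (c * (f y).2 * c⁻¹) c)⁻¹),
        c * (f y).2 * c⁻¹)) x := by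
    refine (MSmoothAt.mul ?_ ?_).prodMk
      (((mSmoothAt_const _ _).mul h2).mul (mSmoothAt_const _ _))
    · exact (hs.isC1sAut.1 c).1.comp_mSmoothAt h1
    · exact MSmoothAt.comp (f := fun y => (f y).2) (hVs.mSmoothAt hV (hx ▸ h1V)) h2
  have h4 := mSmoothAt_toProd_mul h hS hω (mSmoothAt_const ((m, 1) : N × G) x) h3 h1U
    (by simpa [hx] using h1U)
  have h5 := mSmoothAt_toProd_mul h hS hω h4 (mSmoothAt_const ((m⁻¹, 1) : N × G) x)
    (by simpa [toProd, ofProd, hx] using h1U) h1U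
  refine Eq.mp ?_ h5
  congr 1
  ext1 y
  exact congrArg toProd (ofProd_conj h m (f y).1 c (f y).2).symm

/-- Data from which the manifold structure on `N ×_(S,ω) G` is built. -/
def chartedSpaceCore (h : IsFactorSystem S ω) (W : Set G) (hW : IsOpen W) (h1W : 1 ∈ W)
    (ht : ∀ c : TwistedProduct h,
      MSmoothOn 𝕜 (EN × EG) (EN × EG) (fun p => toProd (c * ofProd h p))
        {p | p.2 ∈ W ∧ c.snd * p.2 ∈ W}) : ChartedSpaceCore (N × G) (TwistedProduct h) where
  atlas := range (leftChart h W)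
  chartAt := leftChart h W
  mem_chart_source x := by simpa [leftChart] using h1W
  chart_mem_atlas := mem_range_self
  open_source := by
    have : IsTopologicalGroup G := LieGrp.isTopologicalGroup 𝕜 EG G
    rintro _ _ ⟨a, rfl⟩ ⟨b, rfl⟩
    rw [leftChart_symm_trans_source]
    exact (hW.preimage continuous_snd).inter (hW.preimage (by fun_prop))
  continuousOn_toFun := by
    rintro _ _ ⟨a, rfl⟩ ⟨b, rfl⟩
    have h1 := (ht (b⁻¹ * a)).1
    refine ContinuousOn.mono (ContinuousOn.congr h1 ?_) (t := _) ?_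
    · intro p _
      simp [leftChart_apply, leftChart_symm_apply, mul_assoc]
    · intro p hp
      rw [leftChart_symm_trans_source] at hp
      simpa [mul_assoc] using hp

theorem exists_lieGrpStructure (hs : IsSmoothFactorSystem 𝕜 EG EN S ω) :
    ∃ L : LieGrpStructure 𝕜 (EN × EG) (TwistedProduct hs.toIsFactorSystem),
      IsDiffeoOnStrip EN EG L := by
  have : IsTopologicalGroup G := LieGrp.isTopologicalGroup 𝕜 EG G
  have h := hs.toIsFactorSystem
  obtain ⟨U, hU, h1U, hS, hω⟩ := exists_smooth_nhds_one hs
  -- If `p.2` and `c.snd * p.2` lie in `W`, then `c.snd = (c.snd * p.2) * p.2⁻¹` lies in `U`.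
  obtain ⟨W, hW, h1W, hWU⟩ : ∃ W : Set G, IsOpen W ∧ 1 ∈ W ∧
      ∀ u ∈ W, ∀ v ∈ W, u * v⁻¹ ∈ U := by
    have : Continuous fun p : G × G => p.1 * p.2⁻¹ := by fun_prop
    obtain ⟨A, B, hA, h1A, hB, h1B, hAB⟩ := mem_nhds_prod_iff'.1
      ((hU.preimage this).mem_nhds (x := (1, 1)) (by simpa using h1U))
    exact ⟨A ∩ B, hA.inter hB, ⟨h1A, h1B⟩, fun u hu v hv =>
      hAB (a := (u, v)) ⟨hu.1, hv.2⟩⟩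
  have hWU' : ∀ u ∈ W, u ∈ U := fun u hu => by simpa using hWU u hu 1 h1W
  have ht' : ∀ (c : TwistedProduct h) (p : N × G), p.2 ∈ W → c.snd * p.2 ∈ W →
      MSmoothAt 𝕜 (EN × EG) (EN × EG) (fun p => toProd (c * ofProd h p)) p := by
    intro c p hp hp'
    refine mSmoothAt_toProd_mul h hS hω (mSmoothAt_const (toProd c) p) (mSmoothAt_id p) ?_
      (hWU' _ hp)
    simpa using hWU _ hp' _ hp
  have ht : ∀ c : TwistedProduct h,
      MSmoothOn 𝕜 (EN × EG) (EN × EG) (fun p => toProd (c * ofProd h p))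
        {p | p.2 ∈ W ∧ c.snd * p.2 ∈ W} := fun c =>
    mSmoothOn_of_mSmoothAt fun p hp => ht' c p hp.1 hp.2
  let C := chartedSpaceCore h W hW h1W ht
  let tX : TopologicalSpace (TwistedProduct h) := C.toTopologicalSpace
  let cX : ChartedSpace (N × G) (TwistedProduct h) := C.toChartedSpace
  let Φ : TwistedProduct h → OpenPartialHomeomorph (TwistedProduct h) (N × G) := fun a =>
    C.openPartialHomeomorph (leftChart h W a) (mem_range_self a)
  have hΦ : ∀ a, Φ a ∈ atlas (N × G) (TwistedProduct h) := fun a =>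
    chart_mem_atlas (N × G) a
  have hatlas : ∀ Ψ ∈ atlas (N × G) (TwistedProduct h), ∃ a, Ψ = Φ a := by
    intro Ψ hΨ
    obtain ⟨_, ⟨a, rfl⟩, ha⟩ := mem_iUnion₂.1 hΨ
    exact ⟨a, ha⟩
  have hcompat : ∀ Ψ ∈ atlas (N × G) (TwistedProduct h),
      ∀ Ψ' ∈ atlas (N × G) (TwistedProduct h),
      MSmoothOn 𝕜 (EN × EG) (EN × EG) (Ψ' ∘ Ψ.symm) (Ψ.target ∩ Ψ.symm ⁻¹' Ψ'.source) := by
    intro Ψ hΨ Ψ' hΨ'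
    obtain ⟨a, rfl⟩ := hatlas Ψ hΨ
    obtain ⟨b, rfl⟩ := hatlas Ψ' hΨ'
    have h1 : Φ b ∘ (Φ a).symm = fun p => toProd ((b⁻¹ * a) * ofProd h p) := by
      ext1 p
      exact congrArg toProd (mul_assoc _ _ _).symm
    rw [h1]
    refine (ht (b⁻¹ * a)).mono fun p hp => ⟨hp.1.2, ?_⟩
    have hp2 : b.snd⁻¹ * (a.snd * p.2) ∈ W := hp.2
    simpa [mul_assoc] using hp2
  let cX' : ChartedSpace (EN × EG) (TwistedProduct h) :=
    ChartedSpace.comp (EN × EG) (N × G) (TwistedProduct h)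
  have hman : SmoothManifold 𝕜 (EN × EG) (TwistedProduct h) := SmoothManifold.comp hcompat
  have hchart : ∀ a x : TwistedProduct h, a.snd⁻¹ * x.snd ∈ W →
      MSmoothAt 𝕜 (EN × EG) (EN × EG) (fun x => toProd (a⁻¹ * x)) x := fun a x hx =>
    (mSmoothOn_chart_of_comp hcompat (hΦ a)).mSmoothAt (Φ a).open_source hx
  have hsymm : ∀ (a : TwistedProduct h) (p : N × G), p.2 ∈ W →
      MSmoothAt 𝕜 (EN × EG) (EN × EG) (fun p => a * ofProd h p) p := fun a p hp =>
    (mSmoothOn_chart_symm_of_comp hcompat (hΦ a)).mSmoothAt (Φ a).open_target ⟨mem_univ _, hp⟩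
  have hto : ∀ x : TwistedProduct h, x.snd ∈ W →
      MSmoothAt 𝕜 (EN × EG) (EN × EG) (fun x : TwistedProduct h => toProd x) x := fun x hx => by
    simpa using hchart 1 x (by simpa [one_def] using hx)
  have hof : ∀ p : N × G, p.2 ∈ W →
      MSmoothAt 𝕜 (EN × EG) (EN × EG) (fun p : N × G => ofProd h p) p := fun p hp => by
    simpa using hsymm 1 p hp
  have hleft : ∀ a : TwistedProduct h,
      MSmooth 𝕜 (EN × EG) (EN × EG) (fun x : TwistedProduct h => a * x) := fun a =>
    mSmooth_of_mSmoothAt fun x => by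
      -- Since `a * y = (a * x) * (x⁻¹ * y)`, left translation is the identity in the charts centred
      -- at `x` and `a * x`.
      have h1 := hchart x x (by simpa using h1W)
      have h2 := MSmoothAt.comp (f := fun y => toProd (x⁻¹ * y))
        (hsymm (a * x) _ (by simpa [toProd, one_def] using h1W)) h1
      simpa [mul_assoc] using h2
  have hto1 := hto 1 h1W
  have hlie : LieGrp 𝕜 (EN × EG) (TwistedProduct h) := by
    refine LieGrp.of_local hleft ?_ ?_ fun a => ?_
    · have h1 := mSmoothAt_toProd_mul h hS hω
        (MSmoothAt.comp (f := fun p : TwistedProduct h × TwistedProduct h => p.1) (x := 1) hto1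
          (mSmoothAt_fst _))
        (MSmoothAt.comp (f := fun p : TwistedProduct h × TwistedProduct h => p.2) (x := 1) hto1
          (mSmoothAt_snd _)) h1U h1U
      exact (hof _ (by simpa using h1W)).comp h1
    · have h1 := mSmoothAt_toProd_inv h hS hω hto1 h1U (by simpa [one_def, toProd] using h1U)
      exact (hof _ (by simpa using h1W)).comp h1
    · have h1 := mSmoothAt_toProd_conj hs a hto1 rfl
      exact (hof _ (by simpa using h1W)).comp h1
  have himg : IsOpen {x : TwistedProduct h | x.snd ∈ W} := by
    have := (Φ 1).open_source
    have h1 : (Φ 1).source = {x : TwistedProduct h | x.snd ∈ W} := by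
      ext x
      change (1 : G)⁻¹ * x.snd ∈ W ↔ _
      simp
    rwa [h1] at this
  refine ⟨⟨tX, cX', hlie⟩, W, hW, h1W, isOpen_univ.prod hW, ?_, ?_, toProd, fun p _ => rfl, ?_⟩
  · rw [image_ofProd]
    exact himg
  · exact mSmoothOn_of_mSmoothAt fun p hp => hof p hp.2
  · rw [image_ofProd]
    exact mSmoothOn_of_mSmoothAt fun x hx => hto x hx

end Smooth

end TwistedProduct

namespace TwistedProduct

/-! ### Structures in which a strip is an open submanifold. -/

section Strip

variable {𝕜 EN EG E E' : Type*} [RCLike 𝕜]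
  [AddCommGroup EN] [Module 𝕜 EN] [TopologicalSpace EN] [LocallyConvexTVS 𝕜 EN]
  [AddCommGroup EG] [Module 𝕜 EG] [TopologicalSpace EG] [LocallyConvexTVS 𝕜 EG]
  [AddCommGroup E] [Module 𝕜 E] [TopologicalSpace E] [LocallyConvexTVS 𝕜 E]
  [AddCommGroup E'] [Module 𝕜 E'] [TopologicalSpace E'] [LocallyConvexTVS 𝕜 E']
  {N G : Type*} [Group N] [TopologicalSpace N] [ChartedSpace EN N] [LieGrp 𝕜 EN N]
  [Group G] [TopologicalSpace G] [ChartedSpace EG G] [LieGrp 𝕜 EG G]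
  {S : G → MulAut N} {ω : G → G → N} {h : IsFactorSystem S ω}
  [tX : TopologicalSpace (TwistedProduct h)] [cX : ChartedSpace E (TwistedProduct h)]
  {U : Set G}

theorem mSmoothAt_toProd (hd : IsOpenDiffeoOn 𝕜 (EN × EG) E (ofProd h) (univ ×ˢ U))
    {x : TwistedProduct h} (hx : x.snd ∈ U) :
    MSmoothAt 𝕜 E (EN × EG) (fun x : TwistedProduct h => toProd x) x := by
  obtain ⟨-, himg, -, r, hr, hrs⟩ := hd
  rw [image_ofProd] at himg hrs
  refine (hrs.congr himg fun y hy => ?_).mSmoothAt himg hx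
  exact hr (x := toProd y) ⟨mem_univ _, hy⟩

theorem mSmoothAt_ofProd (hd : IsOpenDiffeoOn 𝕜 (EN × EG) E (ofProd h) (univ ×ˢ U))
    {p : N × G} (hp : p.2 ∈ U) : MSmoothAt 𝕜 (EN × EG) E (fun p => ofProd h p) p :=
  hd.2.2.1.mSmoothAt hd.1 ⟨mem_univ _, hp⟩

theorem mSmooth_of_comp_ofProd [LieGrp 𝕜 E (TwistedProduct h)] {X : Type*} [Group X]
    [TopologicalSpace X] [ChartedSpace E' X] [LieGrp 𝕜 E' X]
    (hd : IsOpenDiffeoOn 𝕜 (EN × EG) E (ofProd h) (univ ×ˢ U)) (h1U : 1 ∈ U)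
    (φ : TwistedProduct h →* X)
    (hφ : MSmoothAt 𝕜 (EN × EG) E' (fun p => φ (ofProd h p)) 1) : MSmooth 𝕜 E E' φ :=
  mSmooth_of_hom φ (MSmoothAt.comp (f := fun x => toProd x) (x := 1) hφ
    (mSmoothAt_toProd hd h1U))

/-- The local section is `g ↦ (1, g)`. The strip contains all of `N × {1}`, so the first coordinate
is smooth near the image of `N`, which makes the inclusion initial. -/
theorem isLieExtension_extension [LieGrp 𝕜 E (TwistedProduct h)]
    (hd : IsOpenDiffeoOn 𝕜 (EN × EG) E (ofProd h) (univ ×ˢ U)) (hU : IsOpen U) (h1U : 1 ∈ U) :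
    IsLieExtension 𝕜 EN E EG (extension h) := by
  refine IsLieExtension.of_local_section (U := U) (s := fun g => ofProd h (1, g)) ?_ ?_ ?_ hU h1U
    (fun x _ => rfl) ?_
  · exact mSmooth_of_mSmoothAt fun n => MSmoothAt.comp (f := fun n : N => (n, (1 : G)))
      (mSmoothAt_ofProd hd h1U) ((mSmoothAt_id n).prodMk (mSmoothAt_const _ _))
  · exact mSmooth_of_comp_ofProd hd h1U _ (mSmoothAt_snd _)
  · intro f x hf
    exact MSmoothAt.comp (f := fun y => toProd ((extension h).inl (f y))) (mSmoothAt_fst _)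
      (MSmoothAt.comp (mSmoothAt_toProd hd h1U) hf)
  · exact mSmoothOn_of_mSmoothAt fun g hg => MSmoothAt.comp (f := fun g : G => ((1 : N), g))
      (mSmoothAt_ofProd hd hg) ((mSmoothAt_const _ _).prodMk (mSmoothAt_id g))

/-- The inverse is smooth because `ι n = (n, g) * (1, g)⁻¹` recovers the `N`-component, and `ι` is
initial. -/
theorem isOpenDiffeoOn_of_isLieExtension [LieGrp 𝕜 E (TwistedProduct h)]
    (hs : MSmoothOn 𝕜 (EN × EG) E (ofProd h) (univ ×ˢ U)) (hU : IsOpen U)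
    (hext : IsLieExtension 𝕜 EN E EG (extension h)) :
    IsOpenDiffeoOn 𝕜 (EN × EG) E (ofProd h) (univ ×ˢ U) := by
  have hq := hext.smooth_rightHom
  have himg : IsOpen {x : TwistedProduct h | x.snd ∈ U} :=
    hU.preimage (continuousOn_univ.1 hq.1)
  refine ⟨isOpen_univ.prod hU, ?_, hs, toProd, fun p _ => rfl, ?_⟩
  · rwa [image_ofProd]
  · rw [image_ofProd]
    refine mSmoothOn_of_mSmoothAt fun x hx => ?_
    have hq' : MSmoothAt 𝕜 E EG (fun x : TwistedProduct h => x.snd) x := hq.mSmoothAt x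
    refine MSmoothAt.prodMk (hext.mSmoothAt_of_inl ?_) hq'
    have h1 : MSmoothAt 𝕜 E E (fun x : TwistedProduct h => ofProd h (1, x.snd)) x :=
      MSmoothAt.comp (f := fun x : TwistedProduct h => ((1 : N), x.snd))
        (hs.mSmoothAt (isOpen_univ.prod hU) ⟨mem_univ _, hx⟩) ((mSmoothAt_const _ _).prodMk hq')
    have h2 : (fun x : TwistedProduct h => (extension h).inl x.fst) =
        fun x => x * (ofProd h (1, x.snd))⁻¹ := by
      ext1 x
      rw [eq_mul_inv_iff_mul_eq]
      change ofProd h (x.fst, 1) * ofProd h (1, x.snd) = x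
      simp only [ofProd_mul, map_one, h.left_one, mul_one, one_mul]
      rfl
    rw [h2]
    exact (mSmoothAt_id x).mul h1.inv

end Strip

/-! ### Uniqueness and equivalence of structures. -/

section Structures

variable {𝕜 EN EG E E' : Type*} [RCLike 𝕜]
  [AddCommGroup EN] [Module 𝕜 EN] [TopologicalSpace EN] [LocallyConvexTVS 𝕜 EN]
  [AddCommGroup EG] [Module 𝕜 EG] [TopologicalSpace EG] [LocallyConvexTVS 𝕜 EG]
  [AddCommGroup E] [Module 𝕜 E] [TopologicalSpace E] [LocallyConvexTVS 𝕜 E]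
  [AddCommGroup E'] [Module 𝕜 E'] [TopologicalSpace E'] [LocallyConvexTVS 𝕜 E']
  {N G : Type*} [Group N] [TopologicalSpace N] [ChartedSpace EN N] [LieGrp 𝕜 EN N]
  [Group G] [TopologicalSpace G] [ChartedSpace EG G] [LieGrp 𝕜 EG G]
  {S : G → MulAut N} {ω : G → G → N} {h : IsFactorSystem S ω}

theorem isExtensionWith_of_isDiffeoOnStrip (L : LieGrpStructure 𝕜 E (TwistedProduct h))
    (hL : IsDiffeoOnStrip EN EG L) : IsExtensionWith EN EG L := by
  let := L.top
  let := L.charts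
  have := L.lieGrp
  obtain ⟨U, hU, h1U, hd⟩ := hL
  exact isLieExtension_extension hd hU h1U

theorem isDiffeoOnStrip_of_isExtensionWith (L : LieGrpStructure 𝕜 E (TwistedProduct h))
    (hs : IsSmoothOnStrip EN EG L) (hL : IsExtensionWith EN EG L) : IsDiffeoOnStrip EN EG L := by
  let := L.top
  let := L.charts
  have := L.lieGrp
  obtain ⟨U, hU, h1U, hs⟩ := hs
  exact ⟨U, hU, h1U, isOpenDiffeoOn_of_isLieExtension hs hU hL⟩

theorem mSmooth_id_of_isDiffeoOnStrip (L : LieGrpStructure 𝕜 E (TwistedProduct h))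
    (L' : LieGrpStructure 𝕜 E' (TwistedProduct h)) (hL : IsDiffeoOnStrip EN EG L)
    (hL' : IsDiffeoOnStrip EN EG L') :
    MSmooth 𝕜 E E' (tM := L.top) (cM := L.charts) (tM' := L'.top) (cM' := L'.charts)
      (id : TwistedProduct h → TwistedProduct h) := by
  obtain ⟨U, hU, h1U, hd⟩ := hL
  obtain ⟨V, hV, h1V, hd'⟩ := hL'
  -- Two topologies and atlases live on the same type, so the instances are passed by hand.
  have h1 := @mSmoothAt_ofProd 𝕜 EN EG E' _ _ _ _ _ _ _ _ _ _ _ _ _ N G _ _ _ _ _ _ _ _ S ω h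
    L'.top L'.charts V hd' 1 h1V
  exact @mSmooth_of_comp_ofProd 𝕜 EN EG E E' _ _ _ _ _ _ _ _ _ _ _ _ _ _ _ _ _ N G
    _ _ _ _ _ _ _ _ S ω h L.top L.charts U L.lieGrp _ _ L'.top L'.charts L'.lieGrp hd h1U
    (MonoidHom.id _) h1

theorem same_of_isDiffeoOnStrip (L : LieGrpStructure 𝕜 E (TwistedProduct h))
    (L' : LieGrpStructure 𝕜 E' (TwistedProduct h)) (hL : IsDiffeoOnStrip EN EG L)
    (hL' : IsDiffeoOnStrip EN EG L') : L.Same L' :=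
  ⟨mSmooth_id_of_isDiffeoOnStrip L L' hL hL', mSmooth_id_of_isDiffeoOnStrip L' L hL' hL⟩

theorem lieEquivalent_of_isDiffeoOnStrip {H : Type*} [Group H] [TopologicalSpace H]
    [ChartedSpace E' H] [LieGrp 𝕜 E' H] {ext : GroupExtension N H G}
    (hext : IsLieExtension 𝕜 EN E' EG ext) {σ : ext.Section} (hσ : IsC1s 𝕜 EG E' σ)
    (h : IsFactorSystem (sectionAct σ) (sectionCocycle σ))
    (L : LieGrpStructure 𝕜 E (TwistedProduct h)) (hL : IsDiffeoOnStrip EN EG L) :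
    LieEquivalent 𝕜 E' E (tH' := L.top) (cH' := L.charts) ext (extension h) := by
  let := L.top
  let := L.charts
  have := L.lieGrp
  obtain ⟨U, hU, h1U, hd⟩ := hL
  obtain ⟨hσ1, V, hV, h1V, hσV⟩ := hσ
  have hσ' : ∀ x ∈ V, MSmoothAt 𝕜 EG E' σ x := fun x hx => hσV.mSmoothAt hV hx
  let ψ := sectionEquiv σ h
  refine ⟨ψ.symm, ?_, ?_⟩
  · refine mSmooth_of_hom (ψ.symm.toMulEquiv.toMonoidHom) ?_
    have hq1 : MSmoothAt 𝕜 E' EG ext.rightHom 1 := hext.smooth_rightHom.mSmoothAt 1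
    -- After `ι`, this component is `y * (σ (q y))⁻¹`.
    have h1 : MSmoothAt 𝕜 E' EN (fun y => (ψ.symm y).fst) 1 := by
      refine hext.mSmoothAt_of_inl ?_
      simp only [ψ, inl_sectionEquiv_symm_fst]
      exact (mSmoothAt_id _).mul (MSmoothAt.comp (hσ' _ (by simpa using h1V)) hq1).inv
    have h2 : MSmoothAt 𝕜 E' (EN × EG) (fun y => toProd (ψ.symm y)) 1 := by
      refine h1.prodMk ?_
      simp only [ψ, sectionEquiv_symm_snd]
      exact hq1
    exact (mSmoothAt_ofProd hd (by simpa [ψ, sectionEquiv_symm_snd] using h1U)).comp h2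
  · refine mSmooth_of_comp_ofProd hd h1U ψ.toMulEquiv.toMonoidHom ?_
    exact (hext.smooth_inl.comp_mSmoothAt (mSmoothAt_fst 1)).mul
      (MSmoothAt.comp (hσ' _ h1V) (mSmoothAt_snd 1))

end Structures

end TwistedProduct

end LCLie

theorem mainTheorem3 {𝕜 : Type*} [RCLike 𝕜]
    {EN EG : Type*}
    [AddCommGroup EN] [Module 𝕜 EN] [TopologicalSpace EN] [LocallyConvexTVS 𝕜 EN]
    [AddCommGroup EG] [Module 𝕜 EG] [TopologicalSpace EG] [LocallyConvexTVS 𝕜 EG]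
    {N G : Type*}
    [Group N] [TopologicalSpace N] [ChartedSpace EN N] [LieGrp 𝕜 EN N]
    [Group G] [TopologicalSpace G] [ChartedSpace EG G] [LieGrp 𝕜 EG G] :
    -- the Lie group structure on `N ×_(S,ω) G`: existence, extension property, uniqueness
    (∀ (S : G → MulAut N) (ω : G → G → N) (h : IsSmoothFactorSystem 𝕜 EG EN S ω),
      ∃ L : LieGrpStructure 𝕜 (EN × EG) (TwistedProduct h.toIsFactorSystem),
        IsDiffeoOnStrip EN EG L ∧
        IsExtensionWith EN EG L ∧
        ∀ {E : Type*} [AddCommGroup E] [Module 𝕜 E] [TopologicalSpace E] [LocallyConvexTVS 𝕜 E]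
          (L' : LieGrpStructure 𝕜 E (TwistedProduct h.toIsFactorSystem)),
          (IsDiffeoOnStrip EN EG L' ∨ (IsSmoothOnStrip EN EG L' ∧ IsExtensionWith EN EG L')) →
            L.Same L') ∧
    -- every extension arises in this way
    (∀ {EH H : Type*}
      [AddCommGroup EH] [Module 𝕜 EH] [TopologicalSpace EH] [LocallyConvexTVS 𝕜 EH]
      [Group H] [TopologicalSpace H] [ChartedSpace EH H] [LieGrp 𝕜 EH H]
      (ext : GroupExtension N H G), IsLieExtension 𝕜 EN EH EG ext →
        (∃ σ : ext.Section, IsC1s 𝕜 EG EH σ) ∧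
        ∀ σ : ext.Section, IsC1s 𝕜 EG EH σ →
          ∃ h : IsSmoothFactorSystem 𝕜 EG EN (sectionAct σ) (sectionCocycle σ),
            ∀ L : LieGrpStructure 𝕜 (EN × EG) (TwistedProduct h.toIsFactorSystem),
              IsDiffeoOnStrip EN EG L →
                LieEquivalent 𝕜 EH (EN × EG) (tH' := L.top) (cH' := L.charts)
                  ext (TwistedProduct.extension h.toIsFactorSystem)) := by
  refine ⟨fun S ω h => ?_, fun ext hext => ⟨hext.exists_section, fun σ hσ => ?_⟩⟩
  · obtain ⟨L, hL⟩ := TwistedProduct.exists_lieGrpStructure h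
    refine ⟨L, hL, TwistedProduct.isExtensionWith_of_isDiffeoOnStrip L hL, fun L' hL' => ?_⟩
    refine TwistedProduct.same_of_isDiffeoOnStrip L L' hL (hL'.elim id fun h' => ?_)
    exact TwistedProduct.isDiffeoOnStrip_of_isExtensionWith L' h'.1 h'.2
  · exact ⟨hext.isSmoothFactorSystem hσ, fun L hL =>
      TwistedProduct.lieEquivalent_of_isDiffeoOnStrip hext hσ _ L hL⟩
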